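/- **Setting.** Let $d\in\mathbb N$, let $\pi_u:\mathbb R^d\to(0,\infty)$ be a probability density with Gaussian tails, i.e. $\pi_u(x)\le A e^{-a\|x\|^2}$ for some $A$ and $a>0$ (for instance a nondegenerate Gaussian density, or one proportional to a Gaussian density times $e^{-\Psi}$ with $\Psi\ge 0$), and let $\nu_u(\mathrm dx)=\pi_u(x)\,\mathrm dx$. Let $\varepsilon_0>0$. For potentials $\Phi_\varepsilon:\mathbb R^d\to\mathbb R$, $0<\varepsilon\le\varepsilon_0$, put $$\nu_\varepsilon(\mathrm du)=\frac1{Z_\varepsilon}e^{-\Phi_\varepsilon(u)/\varepsilon}\,\nu_u(\mathrm du),\qquad Z_\varepsilon=\int e^{-\Phi_\varepsilon/\varepsilon}\,\mathrm d\nu_u,\qquad I_\varepsilon=\Phi_\varepsilon-\varepsilon\log\pi_u .$$ **Assumption (A)** on $(\Phi_\varepsilon)_\varepsilon$ and points $u_\varepsilon\in\mathbb R^d$: 1. $\Phi_\varepsilon\ge -c$ on $\mathbb R^d$ for all $0<\varepsilon\le\varepsilon_0$, with a constant $c$ independent of $\varepsilon$; 2. $\pi_u$ and all $\Phi_\varepsilon$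 are $C^3$; $u_\varepsilon$ is the unique minimizer of $I_\varepsilon$, with $I_\varepsilon(u_\varepsilon)=0$, $\nabla I_\varepsilon(u_\varepsilon)=0$ and $\nabla^2I_\varepsilon(u_\varepsilon)$ positive definite, for all $0<\varepsilon\le\varepsilon_0$; 3. as $\varepsilon\downarrow0$, $u_\varepsilon$ converges in $\mathbb R^d$ and $\nabla^2\Phi_\varepsilon(u_\varepsilon)$ converges to a positive definite matrix; 4. for each $r>0$ there are $\varepsilon_r>0$, $\delta_r>0$, $K_r<\infty$ such that for all $0<\varepsilon\le\varepsilon_r$: $I_\varepsilon(x)\ge\delta_r$ for every $x\notin B_r(u_\varepsilon)$, and $\|\nabla^3\log\pi_u(x)\|\le K_r$, $\|\nabla^3\Phi_\varepsilon(x)\|\le K_r$ for every $\|x\|\le r$. The Laplace approximation of $\nu_\varepsilon$ is $\mathcal L_\varepsilon=\mathcal N(u_\varepsilon,\varepsilon C_\varepsilon)$, $C_\varepsilon^{-1}=\nabla^2I_\varepsilon(u_\varepsilon)$; let $\ell_\varepsilon$ be its Lebesgue density. **Theorem.** (a) Under (A), $D_{\mathrm{KL}}(\nu_\varepsilon\,\|\,\mathcal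 L_\varepsilon)$ is finite for all small $\varepsilon>0$ and $$D_{\mathrm{KL}}(\nu_\varepsilon\,\|\,\mathcal L_\varepsilon)=O(\varepsilon^{1/2})\qquad(\varepsilon\downarrow0).$$ (b) Let the observations $y^{(\varepsilon)}$ be random, on a common probability space, and let $\Phi_\varepsilon=\Phi_\varepsilon(\cdot\,;y^{(\varepsilon)})$, $u_\varepsilon=u_\varepsilon(y^{(\varepsilon)})$, $\nu_\varepsilon$, $\mathcal L_\varepsilon$, $\ell_\varepsilon$ be the corresponding random objects. Suppose that (A) holds almost surely (with constants and limits that may depend on the realization, but with $\varepsilon_0$ fixed), and that for all $0<\varepsilon\le\varepsilon_0$ the variable $D_{\mathrm{KL}}(\nu_\varepsilon\|\nu_u)$ is integrable, and $D_{\mathrm{KL}}(\nu_\varepsilon\|\mathcal L_\varepsilon)$ is measurable and almost surely at most $\kappa$, where $\kappa$ is an integrable random variable that does not depend on $\varepsilon$. Put $$\mathrm{EIG}_\varepsilon=\mathbb E\big[D_{\mathrm{KL}}(\nu_\varepsilon\|\nu_u)\big],\qquad \mathrm{LB}_\varepsilon=\mathbb E\Big[\int\log\frac{\ell_\varepsilon(x)}{\pi_u(x)}\,\nu_\varepsilon(\mathrm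 dx)\Big].$$ Then for all $0<\varepsilon\le\varepsilon_0$ the outer expectation in $\mathrm{LB}_\varepsilon$ is that of an integrable variable and $\mathrm{LB}_\varepsilon\le\mathrm{EIG}_\varepsilon$, and the bound becomes tight: $\mathrm{EIG}_\varepsilon-\mathrm{LB}_\varepsilon\to0$ as $\varepsilon\downarrow0$. -/

import Mathlib

open MeasureTheory ProbabilityTheory Filter Topology Asymptotics InformationTheory

noncomputable section

namespace LaplaceKL

/-- The Hessian matrix `∇² f (x)` of a function on `ℝ^d`. -/
def hessian {d : ℕ} (f : EuclideanSpace ℝ (Fin d) → ℝ) (x : EuclideanSpace ℝ (Fin d)) :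
    Matrix (Fin d) (Fin d) ℝ :=
  Matrix.of fun i j =>
    iteratedFDeriv ℝ 2 f x ![EuclideanSpace.single i (1 : ℝ), EuclideanSpace.single j (1 : ℝ)]

/-- `prior` is a positive probability density with Gaussian tails. This is the case for a
nondegenerate Gaussian density, and for every density proportional to `exp (-Ψ)` times a Gaussian
density with `Ψ ≥ 0`, i.e. for a prior that is the posterior of earlier steps started from a
Gaussian prior. -/
structure IsPriorDensity {d : ℕ} (prior : EuclideanSpace ℝ (Fin d) → ℝ) : Prop where
  pos : ∀ x, 0 < prior x
  integral_eq_one : ∫ x, prior x = 1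
  gaussian_tail : ∃ A a : ℝ, 0 < a ∧ ∀ x, prior x ≤ A * Real.exp (-a * ‖x‖ ^ 2)

/-- The prior measure with Lebesgue density `prior`. -/
def priorMeasure {d : ℕ} (prior : EuclideanSpace ℝ (Fin d) → ℝ) :
    Measure (EuclideanSpace ℝ (Fin d)) :=
  volume.withDensity fun x => ENNReal.ofReal (prior x)

/-- The posterior `Z⁻¹ exp (-φ / ε) · prior`, with `Z` the normalizing constant. -/
def posterior {d : ℕ} (prior φ : EuclideanSpace ℝ (Fin d) → ℝ) (ε : ℝ) :
    Measure (EuclideanSpace ℝ (Fin d)) :=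
  (priorMeasure prior).tilted fun x => -(1 / ε) * φ x

/-- `I_ε = φ - ε log prior`. -/
def regPotential {d : ℕ} (prior φ : EuclideanSpace ℝ (Fin d) → ℝ) (ε : ℝ)
    (x : EuclideanSpace ℝ (Fin d)) : ℝ :=
  φ x - ε * Real.log (prior x)

/-- `C_ε`, the inverse of the Hessian of `I_ε` at `m`. -/
def laplaceCov {d : ℕ} (prior φ : EuclideanSpace ℝ (Fin d) → ℝ) (ε : ℝ)
    (m : EuclideanSpace ℝ (Fin d)) : Matrix (Fin d) (Fin d) ℝ :=
  (hessian (regPotential prior φ ε) m)⁻¹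

/-- The Laplace approximation `N(m, ε C_ε)`. -/
def laplaceApprox {d : ℕ} (prior φ : EuclideanSpace ℝ (Fin d) → ℝ) (ε : ℝ)
    (m : EuclideanSpace ℝ (Fin d)) : Measure (EuclideanSpace ℝ (Fin d)) :=
  multivariateGaussian m (ε • laplaceCov prior φ ε m)

/-- The Lebesgue density of the Laplace approximation: the exponential
`exp (-(x - m)ᵀ C_ε⁻¹ (x - m) / (2 ε))` divided by `ε^{d/2} √(det (2 π C_ε))`. -/
def laplaceDensity {d : ℕ} (prior φ : EuclideanSpace ℝ (Fin d) → ℝ) (ε : ℝ)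
    (m x : EuclideanSpace ℝ (Fin d)) : ℝ :=
  (ε ^ ((d : ℝ) / 2) * √(((2 * Real.pi) • laplaceCov prior φ ε m).det))⁻¹ *
    Real.exp (-(1 / (2 * ε)) *
      ((fun i => (x - m) i) ⬝ᵥ
        (hessian (regPotential prior φ ε) m).mulVec (fun i => (x - m) i)))

/-- The assumptions on the potentials `Φ ε` and the minimizers `u ε` of `I_ε`, for `0 < ε ≤ ε₀`. -/
structure LaplaceAssumption {d : ℕ} (ε₀ : ℝ) (prior : EuclideanSpace ℝ (Fin d) → ℝ)
    (Φ : ℝ → EuclideanSpace ℝ (Fin d) → ℝ) (u : ℝ → EuclideanSpace ℝ (Fin d)) : Prop where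
  contDiff_prior : ContDiff ℝ 3 prior
  contDiff_potential : ∀ ε, 0 < ε → ε ≤ ε₀ → ContDiff ℝ 3 (Φ ε)
  /-- `u ε` is the unique minimizer of `I_ε`. -/
  unique_min : ∀ ε, 0 < ε → ε ≤ ε₀ → ∀ x, x ≠ u ε →
    regPotential prior (Φ ε) ε (u ε) < regPotential prior (Φ ε) ε x
  min_eq_zero : ∀ ε, 0 < ε → ε ≤ ε₀ → regPotential prior (Φ ε) ε (u ε) = 0
  gradient_eq_zero : ∀ ε, 0 < ε → ε ≤ ε₀ → gradient (regPotential prior (Φ ε) ε) (u ε) = 0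
  hessian_posDef : ∀ ε, 0 < ε → ε ≤ ε₀ → (hessian (regPotential prior (Φ ε) ε) (u ε)).PosDef
  tendsto_min : ∃ uStar, Tendsto u (𝓝[>] 0) (𝓝 uStar)
  tendsto_hessian : ∃ HStar : Matrix (Fin d) (Fin d) ℝ, HStar.PosDef ∧
    Tendsto (fun ε => hessian (Φ ε) (u ε)) (𝓝[>] 0) (𝓝 HStar)
  separation_and_bounds : ∀ r : ℝ, 0 < r → ∃ εr δ K : ℝ, 0 < εr ∧ 0 < δ ∧
    ∀ ε, 0 < ε → ε ≤ εr →
      (∀ x, x ∉ Metric.ball (u ε) r → δ ≤ regPotential prior (Φ ε) ε x) ∧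
      (∀ x ∈ Metric.closedBall (0 : EuclideanSpace ℝ (Fin d)) r,
        ‖iteratedFDeriv ℝ 3 (fun z => Real.log (prior z)) x‖ ≤ K ∧
        ‖iteratedFDeriv ℝ 3 (Φ ε) x‖ ≤ K)

/-- The potentials are bounded below, uniformly in `ε`. Least-squares potentials, which are
nonnegative before a constant `c_ε` is subtracted in order to normalize `min I_ε` to zero, satisfy
this when the constants `c_ε` are bounded. -/
def UniformlyBoundedBelow {d : ℕ} (ε₀ : ℝ) (Φ : ℝ → EuclideanSpace ℝ (Fin d) → ℝ) : Prop :=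
  ∃ c : ℝ, ∀ ε, 0 < ε → ε ≤ ε₀ → ∀ x, -c ≤ Φ ε x

/-- The expected information gain: the mean over the observation `y` of the divergence
of the posterior given `y` from the prior. The potential for the observation `y` is `φ y`. -/
def EIG {d : ℕ} {Y Ω : Type*} [MeasurableSpace Ω] (P : Measure Ω)
    (prior : EuclideanSpace ℝ (Fin d) → ℝ) (φ : Y → EuclideanSpace ℝ (Fin d) → ℝ)
    (y : Ω → Y) (ε : ℝ) : ℝ :=
  ∫ ω, (klDiv (posterior prior (φ (y ω)) ε) (priorMeasure prior)).toReal ∂P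

/-- The inner (posterior) expectation of the log-ratio of the Laplace density and the prior. -/
def laplaceGain {d : ℕ} (prior φ : EuclideanSpace ℝ (Fin d) → ℝ) (ε : ℝ)
    (m : EuclideanSpace ℝ (Fin d)) : ℝ :=
  ∫ x, Real.log (laplaceDensity prior φ ε m x / prior x) ∂(posterior prior φ ε)

/-- The lower bound on the expected information gain based on the Laplace approximation: the
expectation of `log (laplaceDensity / prior)` over the joint law of observation and parameter. -/
def EIGLaplaceLowerBound {d : ℕ} {Y Ω : Type*} [MeasurableSpace Ω] (P : Measure Ω)
    (prior : EuclideanSpace ℝ (Fin d) → ℝ) (φ : Y → EuclideanSpace ℝ (Fin d) → ℝ)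
    (m : Y → EuclideanSpace ℝ (Fin d)) (y : Ω → Y) (ε : ℝ) : ℝ :=
  ∫ ω, laplaceGain prior (φ (y ω)) ε (m (y ω)) ∂P

end LaplaceKL

end
/-!
Both `ν_ε` and its Laplace approximation are Lebesgue measure exponentially tilted, by `-I_ε / ε`
and by `-q_ε / ε`, where `q_ε` is the second order Taylor polynomial of `I_ε` at `u_ε`. The
divergence between two tilted measures is the mean of the difference of the exponents plus the
logarithm of the ratio of the normalizers. After the substitution `x = u_ε + √ε y` the exponents
differ, near `u_ε`, by at most `K ‖√ε y‖³ / ε = K √ε ‖y‖³` by Taylor's theorem, and the Gaussian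
lower bound `I_ε ≥ const · ‖x - u_ε‖²` there makes the third moment bounded. Away from `u_ε` one has
`I_ε ≥ δ`, so that part of the exponent makes the weight `exp (-I_ε / ε)` exponentially small in
`1 / ε`, while the rest makes it integrable uniformly in `ε` because of the Gaussian tails of the
prior.

The gap `EIG_ε - LB_ε` is the expectation of `D_KL(ν_ε ‖ 𝓛_ε)`, so its convergence to zero is
dominated convergence.
-/

namespace LaplaceKL

section Tilted

open scoped ENNReal

variable {α β : Type*} [MeasurableSpace α] [MeasurableSpace β] {μ : Measure α} {f g h : α → ℝ}

lemma map_tilted_comp {e : α → β} (he : Measurable e) {φ : β → ℝ} (hφ : Measurable φ) :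
    (μ.tilted fun x => φ (e x)).map e = (μ.map e).tilted φ := by
  ext s hs
  rw [Measure.map_apply he hs, tilted_apply' _ _ (he hs), tilted_apply' _ _ hs,
    integral_map he.aemeasurable (by fun_prop), setLIntegral_map hs (by fun_prop) he]

lemma smul_measure_tilted {c : ℝ≥0∞} (hc : c ≠ 0) (hc' : c ≠ ∞) (f : α → ℝ) :
    (c • μ).tilted f = μ.tilted f := by
  have hc0 : 0 < c.toReal := ENNReal.toReal_pos hc hc'
  ext s hs
  have hdensity (x : α) : ENNReal.ofReal (Real.exp (f x) / ∫ y, Real.exp (f y) ∂(c • μ)) =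
      c⁻¹ * ENNReal.ofReal (Real.exp (f x) / ∫ y, Real.exp (f y) ∂μ) := by
    rw [integral_smul_measure, smul_eq_mul, mul_comm, ← div_div, div_eq_inv_mul,
      ENNReal.ofReal_mul (inv_nonneg.2 hc0.le), ENNReal.ofReal_inv_of_pos hc0,
      ENNReal.ofReal_toReal hc']
  simp_rw [tilted_apply' _ _ hs, hdensity, Measure.restrict_smul, lintegral_smul_measure]
  rw [lintegral_const_mul' _ _ (ENNReal.inv_ne_top.2 hc), smul_eq_mul, ← mul_assoc,
    ENNReal.mul_inv_cancel hc hc', one_mul]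

lemma tilted_eq_tilted_tilted_sub (hg : Integrable (fun x => Real.exp (g x)) μ) (f : α → ℝ) :
    μ.tilted f = (μ.tilted g).tilted (f - g) := by
  rw [tilted_tilted hg, add_sub_cancel]

lemma integrable_exp_sub_tilted (hf : Integrable (fun x => Real.exp (f x)) μ)
    (hg : Integrable (fun x => Real.exp (g x)) μ) :
    Integrable (fun x => Real.exp ((f - g) x)) (μ.tilted g) := by
  rw [integrable_tilted_iff hg]
  simpa only [smul_eq_mul, ← Real.exp_add, Pi.sub_apply, add_sub_cancel] using hf

lemma tilted_absolutelyContinuous_tilted (hg : Integrable (fun x => Real.exp (g x)) μ)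
    (f : α → ℝ) : μ.tilted f ≪ μ.tilted g := by
  rw [tilted_eq_tilted_tilted_sub hg f]
  exact tilted_absolutelyContinuous _ _

lemma llr_tilted_tilted (hf : Integrable (fun x => Real.exp (f x)) μ)
    (hg : Integrable (fun x => Real.exp (g x)) μ) :
    llr (μ.tilted f) (μ.tilted g) =ᵐ[μ.tilted f] fun x =>
      f x - g x - Real.log ((∫ y, Real.exp (f y) ∂μ) / ∫ y, Real.exp (g y) ∂μ) := by
  have hllr := log_rnDeriv_tilted_left_self (integrable_exp_sub_tilted hf hg)
  rw [← tilted_eq_tilted_tilted_sub hg, integral_exp_tilted, add_sub_cancel] at hllr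
  exact (tilted_absolutelyContinuous_tilted hg f).ae_le hllr

variable [NeZero μ]

lemma klDiv_tilted_ne_top (hf : Integrable (fun x => Real.exp (f x)) μ)
    (hg : Integrable (fun x => Real.exp (g x)) μ)
    (hfg : Integrable (fun x => f x - g x) (μ.tilted f)) :
    klDiv (μ.tilted f) (μ.tilted g) ≠ ⊤ := by
  have := isProbabilityMeasure_tilted hf
  exact klDiv_ne_top (tilted_absolutelyContinuous_tilted hg f)
    ((hfg.sub (integrable_const _)).congr (llr_tilted_tilted hf hg).symm)

lemma toReal_klDiv_tilted (hf : Integrable (fun x => Real.exp (f x)) μ)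
    (hg : Integrable (fun x => Real.exp (g x)) μ)
    (hfg : Integrable (fun x => f x - g x) (μ.tilted f)) :
    (klDiv (μ.tilted f) (μ.tilted g)).toReal = (∫ x, f x - g x ∂(μ.tilted f)) +
      Real.log ((∫ x, Real.exp (g x) ∂μ) / ∫ x, Real.exp (f x) ∂μ) := by
  have := isProbabilityMeasure_tilted hf
  have := isProbabilityMeasure_tilted hg
  rw [toReal_klDiv_of_measure_eq (tilted_absolutelyContinuous_tilted hg f) (by simp),
    integral_congr_ae (llr_tilted_tilted hf hg), integral_sub hfg (integrable_const _),
    integral_const, probReal_univ, one_smul, ← inv_div, Real.log_inv, sub_neg_eq_add]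

lemma integral_log_density_div_density_tilted (hf : Integrable (fun x => Real.exp (f x)) μ)
    (hg : Integrable (fun x => Real.exp (g x)) μ) (hh : Integrable (fun x => Real.exp (h x)) μ)
    (hfg : Integrable (fun x => f x - g x) (μ.tilted f))
    (hfh : Integrable (fun x => f x - h x) (μ.tilted f)) :
    ∫ x, Real.log ((Real.exp (g x) / ∫ y, Real.exp (g y) ∂μ) /
      (Real.exp (h x) / ∫ y, Real.exp (h y) ∂μ)) ∂(μ.tilted f) =
      (klDiv (μ.tilted f) (μ.tilted h)).toReal - (klDiv (μ.tilted f) (μ.tilted g)).toReal := by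
  have := isProbabilityMeasure_tilted hf
  have hZf := (integral_exp_pos hf).ne'
  have hZg := (integral_exp_pos hg).ne'
  have hZh := (integral_exp_pos hh).ne'
  have hlog (x) : Real.log ((Real.exp (g x) / ∫ y, Real.exp (g y) ∂μ) /
      (Real.exp (h x) / ∫ y, Real.exp (h y) ∂μ)) = (f x - h x) - (f x - g x) +
        (Real.log (∫ y, Real.exp (h y) ∂μ) - Real.log (∫ y, Real.exp (g y) ∂μ)) := by
    rw [Real.log_div (by positivity) (by positivity), Real.log_div (Real.exp_ne_zero _) hZg,
      Real.log_div (Real.exp_ne_zero _) hZh, Real.log_exp, Real.log_exp]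
    ring
  have hsub : Integrable (fun x => (f x - h x) - (f x - g x)) (μ.tilted f) := hfh.sub hfg
  simp only [hlog]
  rw [integral_add hsub (integrable_const _), integral_sub hfh hfg, integral_const,
    probReal_univ, one_smul, toReal_klDiv_tilted hf hh hfh, toReal_klDiv_tilted hf hg hfg,
    Real.log_div hZh hZf, Real.log_div hZg hZf]
  ring

end Tilted

section QuadForm

open scoped Matrix

variable {ι : Type*} [Fintype ι]

/-- The quadratic form `vᵀ A v` of a square matrix, on Euclidean space. -/
def quadForm (A : Matrix ι ι ℝ) (v : EuclideanSpace ℝ ι) : ℝ :=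
  v.ofLp ⬝ᵥ A *ᵥ v.ofLp

lemma continuous_uncurry_quadForm :
    Continuous fun p : Matrix ι ι ℝ × EuclideanSpace ℝ ι => quadForm p.1 p.2 := by
  unfold quadForm
  fun_prop

lemma continuous_quadForm (A : Matrix ι ι ℝ) : Continuous (quadForm A) :=
  continuous_uncurry_quadForm.comp (Continuous.prodMk_right A)

lemma quadForm_smul_right (A : Matrix ι ι ℝ) (c : ℝ) (v : EuclideanSpace ℝ ι) :
    quadForm A (c • v) = c ^ 2 * quadForm A v := by
  simp only [quadForm, WithLp.ofLp_smul, Matrix.mulVec_smul, smul_dotProduct, dotProduct_smul,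
    smul_eq_mul]
  ring

lemma quadForm_smul_left (A : Matrix ι ι ℝ) (c : ℝ) (v : EuclideanSpace ℝ ι) :
    quadForm (c • A) v = c * quadForm A v := by
  simp only [quadForm, Matrix.smul_mulVec, dotProduct_smul, smul_eq_mul]

lemma quadForm_eq_sq_norm_mul (A : Matrix ι ι ℝ) (v : EuclideanSpace ℝ ι) :
    quadForm A v = ‖v‖ ^ 2 * quadForm A (‖v‖⁻¹ • v) := by
  obtain rfl | hv := eq_or_ne v 0
  · simp [quadForm]
  · rw [← quadForm_smul_right, smul_inv_smul₀ (norm_ne_zero_iff.2 hv)]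

lemma exists_quadForm_bounds_on_sphere {B : Matrix ι ι ℝ} (hB : B.PosDef) :
    ∃ γ M : ℝ, 0 < γ ∧ 0 < M ∧
      ∀ v ∈ Metric.sphere (0 : EuclideanSpace ℝ ι) 1, γ < quadForm B v ∧ quadForm B v < M := by
  have hcompact := isCompact_sphere (0 : EuclideanSpace ℝ ι) 1
  have hcont := (continuous_quadForm B).continuousOn (s := Metric.sphere 0 1)
  have hpos : ∀ v ∈ Metric.sphere (0 : EuclideanSpace ℝ ι) 1, 0 < quadForm B v := fun v hv =>
    hB.dotProduct_mulVec_pos (by simpa using ne_zero_of_mem_unit_sphere ⟨v, hv⟩)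
  obtain ⟨γ, hγ, hlower⟩ := hcompact.exists_forall_le' hcont hpos
  obtain ⟨M, hupper⟩ := hcompact.exists_bound_of_continuousOn hcont
  refine ⟨γ / 2, |M| + 1, by positivity, by positivity, fun v hv => ⟨?_, ?_⟩⟩
  · linarith [hlower v hv]
  · linarith [hupper v hv, le_abs_self M, Real.le_norm_self (quadForm B v)]

lemma exists_eventually_quadForm_bounds {B : Matrix ι ι ℝ} (hB : B.PosDef) :
    ∃ γ M : ℝ, 0 < γ ∧ 0 < M ∧ ∀ᶠ A in 𝓝 B, ∀ v : EuclideanSpace ℝ ι,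
      γ * ‖v‖ ^ 2 ≤ quadForm A v ∧ quadForm A v ≤ M * ‖v‖ ^ 2 := by
  obtain ⟨γ, M, hγ, hM, hsphere⟩ := exists_quadForm_bounds_on_sphere hB
  refine ⟨γ, M, hγ, hM, ?_⟩
  have hnear : ∀ᶠ A in 𝓝 B, ∀ v ∈ Metric.sphere (0 : EuclideanSpace ℝ ι) 1,
      γ < quadForm A v ∧ quadForm A v < M := by
    refine (isCompact_sphere _ _).eventually_forall_of_forall_eventually fun v hv => ?_
    have hcont := continuous_uncurry_quadForm.tendsto (B, v)
    exact (hcont.eventually_const_lt (hsphere v hv).1).and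
      (hcont.eventually_lt_const (hsphere v hv).2)
  filter_upwards [hnear] with A hA v
  obtain rfl | hv := eq_or_ne v 0
  · simp [quadForm]
  · have hunit := hA (‖v‖⁻¹ • v) (by simp [norm_smul, hv])
    rw [quadForm_eq_sq_norm_mul A v, mul_comm γ, mul_comm M]
    exact ⟨by gcongr; exact hunit.1.le, by gcongr; exact hunit.2.le⟩

end QuadForm

section Gaussian

open scoped MatrixOrder RealInnerProductSpace Matrix

section StdGaussian

variable {E : Type*} [NormedAddCommGroup E] [InnerProductSpace ℝ E] [FiniteDimensional ℝ E]
  [MeasurableSpace E] [BorelSpace E]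

lemma integrable_exp_neg_mul_sq_norm {b : ℝ} (hb : 0 < b) :
    Integrable fun x : E => Real.exp (-b * ‖x‖ ^ 2) := by
  refine Integrable.of_integral_ne_zero ?_
  rw [GaussianFourier.integral_rexp_neg_mul_sq_norm hb]
  positivity

lemma charFun_tilted_neg_half_sq_norm (t : E) :
    charFun ((volume : Measure E).tilted fun x => -(1 / 2) * ‖x‖ ^ 2) t =
      Complex.exp (-‖t‖ ^ 2 / 2) := by
  have hZ : ((∫ x : E, Real.exp (-(1 / 2) * ‖x‖ ^ 2) : ℝ) : ℂ) =
      (Real.pi / (1 / 2) : ℂ) ^ (Module.finrank ℝ E / 2 : ℂ) := by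
    have := GaussianFourier.integral_cexp_neg_mul_sq_norm (V := E) (b := 1 / 2) (by norm_num)
    rw [← this, ← integral_complex_ofReal]
    push_cast
    rfl
  have hZ0 : ((∫ x : E, Real.exp (-(1 / 2) * ‖x‖ ^ 2) : ℝ) : ℂ) ≠ 0 :=
    Complex.ofReal_ne_zero.2
      (integral_exp_pos (integrable_exp_neg_mul_sq_norm (by norm_num))).ne'
  have hfourier := GaussianFourier.integral_cexp_neg_mul_sq_norm_add (V := E) (b := 1 / 2)
    (by norm_num) Complex.I t
  have hintegrand (x : E) : (Real.exp (-(1 / 2) * ‖x‖ ^ 2) /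
      ∫ y : E, Real.exp (-(1 / 2) * ‖y‖ ^ 2)) • Complex.exp (⟪x, t⟫ * Complex.I) =
      (∫ y : E, Real.exp (-(1 / 2) * ‖y‖ ^ 2) : ℝ)⁻¹ *
        Complex.exp (-(1 / 2) * ‖x‖ ^ 2 + Complex.I * ⟪t, x⟫) := by
    rw [Complex.exp_add, Complex.real_smul, real_inner_comm, mul_comm Complex.I]
    push_cast
    ring
  simp_rw [charFun_apply, integral_tilted, hintegrand]
  rw [integral_const_mul, hfourier, ← hZ, Complex.ofReal_inv, inv_mul_cancel_left₀ hZ0,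
    Complex.I_sq]
  ring_nf

lemma stdGaussian_eq_tilted :
    stdGaussian E = (volume : Measure E).tilted fun x => -(1 / 2) * ‖x‖ ^ 2 := by
  have := isProbabilityMeasure_tilted (μ := (volume : Measure E))
    (integrable_exp_neg_mul_sq_norm (b := 1 / 2) (by norm_num))
  refine Measure.ext_of_charFun (funext fun t => ?_)
  rw [charFun_stdGaussian, charFun_tilted_neg_half_sq_norm]

end StdGaussian

variable {ι : Type*}

lemma isSymm_of_nonneg {Q : Matrix ι ι ℝ} (hQ : 0 ≤ Q) : Q.IsSymm :=
  (Matrix.nonneg_iff_posSemidef.1 hQ).isHermitian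

variable [Fintype ι] [DecidableEq ι] {S : Matrix ι ι ℝ}

lemma quadForm_inv_toEuclideanCLM {Q : Matrix ι ι ℝ} (hQ : Q.IsSymm) (hdet : Q.det ≠ 0)
    (x : EuclideanSpace ℝ ι) :
    quadForm (Q * Q)⁻¹ (Matrix.toEuclideanCLM (𝕜 := ℝ) Q x) = ‖x‖ ^ 2 := by
  have hcancel : Qᵀ * ((Q * Q)⁻¹ * Q) = 1 := by
    rw [hQ.eq, Matrix.mul_inv_rev, Matrix.mul_assoc, Matrix.nonsing_inv_mul _ hdet.isUnit,
      Matrix.mul_one, Matrix.mul_nonsing_inv _ hdet.isUnit]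
  rw [quadForm, Matrix.ofLp_toEuclideanCLM, Matrix.mulVec_mulVec, ← Matrix.vecMul_transpose,
    ← Matrix.dotProduct_mulVec, Matrix.mulVec_mulVec, hcancel, Matrix.one_mulVec,
    EuclideanSpace.real_norm_sq_eq]
  simp only [dotProduct, sq]

lemma map_const_add_toEuclideanCLM_volume {Q : Matrix ι ι ℝ} (hdet : Q.det ≠ 0)
    (m : EuclideanSpace ℝ ι) :
    (volume : Measure (EuclideanSpace ℝ ι)).map
      (fun x => m + Matrix.toEuclideanCLM (𝕜 := ℝ) Q x) = ENNReal.ofReal |Q.det|⁻¹ • volume := by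
  set T := Matrix.toEuclideanCLM (𝕜 := ℝ) Q
  have hT : LinearMap.det (T : EuclideanSpace ℝ ι →ₗ[ℝ] EuclideanSpace ℝ ι) = Q.det :=
    LinearMap.det_toLin (EuclideanSpace.basisFun ι ℝ).toBasis Q
  have hlinear : (volume : Measure (EuclideanSpace ℝ ι)).map T =
      ENNReal.ofReal |Q.det|⁻¹ • volume := by
    rw [← abs_inv, ← hT]
    exact Measure.map_linearMap_addHaar_eq_smul_addHaar volume (by rwa [hT])
  have hcomp : (fun x => m + T x) = (m + ·) ∘ T := rfl
  rw [hcomp, ← Measure.map_map (by fun_prop) (by fun_prop), hlinear, Measure.map_smul,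
    Measure.IsAddLeftInvariant.map_add_left_eq_self]

lemma det_sqrt_mul_self (hS : S.PosDef) : (CFC.sqrt S).det * (CFC.sqrt S).det = S.det := by
  rw [← Matrix.det_mul, CFC.sqrt_mul_sqrt_self S hS.posSemidef.nonneg]

lemma det_sqrt_ne_zero (hS : S.PosDef) : (CFC.sqrt S).det ≠ 0 :=
  left_ne_zero_of_mul (det_sqrt_mul_self hS ▸ hS.det_pos.ne')

lemma quadForm_inv_toEuclideanCLM_sqrt (hS : S.PosDef) (x : EuclideanSpace ℝ ι) :
    quadForm S⁻¹ (Matrix.toEuclideanCLM (𝕜 := ℝ) (CFC.sqrt S) x) = ‖x‖ ^ 2 := by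
  rw [← quadForm_inv_toEuclideanCLM (isSymm_of_nonneg (CFC.sqrt_nonneg S)) (det_sqrt_ne_zero hS) x,
    CFC.sqrt_mul_sqrt_self S hS.posSemidef.nonneg]

lemma multivariateGaussian_eq_tilted (hS : S.PosDef) (m : EuclideanSpace ℝ ι) :
    multivariateGaussian m S = volume.tilted fun x => -(1 / 2) * quadForm S⁻¹ (x - m) := by
  have hmeas : Measurable fun x => -(1 / 2) * quadForm S⁻¹ (x - m) := by
    have := (continuous_quadForm S⁻¹).measurable
    fun_prop
  have hdet := abs_pos.2 (det_sqrt_ne_zero hS)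
  have hexponent (x : EuclideanSpace ℝ ι) : -(1 / 2) * ‖x‖ ^ 2 = -(1 / 2) *
      quadForm S⁻¹ (m + Matrix.toEuclideanCLM (𝕜 := ℝ) (CFC.sqrt S) x - m) := by
    rw [add_sub_cancel_left, quadForm_inv_toEuclideanCLM_sqrt hS]
  rw [multivariateGaussian, stdGaussian_eq_tilted]
  simp_rw [hexponent]
  rw [map_tilted_comp (φ := fun x => -(1 / 2) * quadForm S⁻¹ (x - m)) (by fun_prop) hmeas,
    map_const_add_toEuclideanCLM_volume (det_sqrt_ne_zero hS),
    smul_measure_tilted (by positivity) ENNReal.ofReal_ne_top]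

lemma integral_exp_neg_half_quadForm_inv (hS : S.PosDef) (m : EuclideanSpace ℝ ι) :
    ∫ x, Real.exp (-(1 / 2) * quadForm S⁻¹ (x - m)) = √((2 * Real.pi) • S).det := by
  have hcont := continuous_quadForm S⁻¹
  have hdet := det_sqrt_ne_zero hS
  have hmap := integral_map (μ := volume) (f := fun x => Real.exp (-(1 / 2) * quadForm S⁻¹ (x - m)))
    (φ := fun x => m + Matrix.toEuclideanCLM (𝕜 := ℝ) (CFC.sqrt S) x) (by fun_prop) (by fun_prop)
  rw [map_const_add_toEuclideanCLM_volume hdet, integral_smul_measure,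
    ENNReal.toReal_ofReal (by positivity), smul_eq_mul, inv_mul_eq_iff_eq_mul₀ (abs_ne_zero.2 hdet)]
    at hmap
  simp_rw [hmap, add_sub_cancel_left, quadForm_inv_toEuclideanCLM_sqrt hS]
  rw [GaussianFourier.integral_rexp_neg_mul_sq_norm (by norm_num), finrank_euclideanSpace,
    Matrix.det_smul, ← det_sqrt_mul_self hS, Real.sqrt_mul (by positivity),
    Real.sqrt_mul_self_eq_abs, Real.sqrt_eq_rpow, ← Real.rpow_natCast_mul (by positivity),
    mul_one_div, mul_comm, div_eq_mul_inv, one_div, inv_inv, mul_comm Real.pi]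

end Gaussian

section GaussianMoments

variable {V : Type*} [NormedAddCommGroup V] [InnerProductSpace ℝ V] [FiniteDimensional ℝ V]
  [MeasurableSpace V] [BorelSpace V] {b : ℝ}

lemma integrable_norm_pow_mul_exp_neg_half_sq_norm (k : ℕ) :
    Integrable fun x : V => ‖x‖ ^ k * Real.exp (-(1 / 2) * ‖x‖ ^ 2) := by
  have hmoment :=
    (IsGaussian.memLp_id (stdGaussian V) k (ENNReal.natCast_ne_top k)).integrable_norm_pow'
  rw [stdGaussian_eq_tilted, integrable_tilted_iff
    (integrable_exp_neg_mul_sq_norm (by norm_num))] at hmoment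
  simpa only [smul_eq_mul, mul_comm, id] using hmoment

lemma integrable_norm_sub_pow_mul_exp (k : ℕ) (hb : 0 < b) (m : V) :
    Integrable fun x : V => ‖x - m‖ ^ k * Real.exp (-b * ‖x - m‖ ^ 2) := by
  refine Integrable.comp_sub_right (f := fun x => ‖x‖ ^ k * Real.exp (-b * ‖x‖ ^ 2)) ?_ m
  have hc : 0 < √(2 * b) := by positivity
  refine (((integrable_norm_pow_mul_exp_neg_half_sq_norm (V := V) k).comp_smul hc.ne').const_mul
    (√(2 * b) ^ k)⁻¹).congr (ae_of_all _ fun x => ?_)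
  have hsq : √(2 * b) ^ 2 = 2 * b := Real.sq_sqrt (by positivity)
  simp only [norm_smul, Real.norm_of_nonneg hc.le, mul_pow, hsq]
  rw [mul_assoc, inv_mul_cancel_left₀ (by positivity)]
  ring_nf

variable (V) in
/-- The Gaussian moment `∫ ‖x‖ ^ k * exp (-b * ‖x‖ ^ 2)`. -/
noncomputable def gaussMoment (k : ℕ) (b : ℝ) : ℝ :=
  ∫ x : V, ‖x‖ ^ k * Real.exp (-b * ‖x‖ ^ 2)

lemma gaussMoment_nonneg (k : ℕ) (b : ℝ) : 0 ≤ gaussMoment V k b :=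
  integral_nonneg fun x => by positivity

lemma gaussMoment_zero_pos (hb : 0 < b) : 0 < gaussMoment V 0 b := by
  simp only [gaussMoment, pow_zero, one_mul]
  exact integral_exp_pos (integrable_exp_neg_mul_sq_norm hb)

lemma integral_norm_sub_pow_mul_exp (k : ℕ) (b : ℝ) (m : V) :
    ∫ x : V, ‖x - m‖ ^ k * Real.exp (-b * ‖x - m‖ ^ 2) = gaussMoment V k b :=
  integral_sub_right_eq_self (fun x => ‖x‖ ^ k * Real.exp (-b * ‖x‖ ^ 2)) m

lemma gaussMoment_div (k : ℕ) (b : ℝ) {ε : ℝ} (hε : 0 < ε) :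
    gaussMoment V k (b / ε) = √ε ^ (Module.finrank ℝ V + k) * gaussMoment V k b := by
  have hs : 0 < √ε := Real.sqrt_pos.2 hε
  have hscale (x : V) : ‖x‖ ^ k * Real.exp (-(b / ε) * ‖x‖ ^ 2) =
      √ε ^ k * (‖(√ε)⁻¹ • x‖ ^ k * Real.exp (-b * ‖(√ε)⁻¹ • x‖ ^ 2)) := by
    rw [norm_smul, norm_inv, Real.norm_of_nonneg hs.le, mul_pow, ← mul_assoc, ← mul_assoc,
      ← mul_pow, mul_inv_cancel₀ hs.ne', one_pow, one_mul, mul_pow, inv_pow, Real.sq_sqrt hε.le]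
    ring_nf
  simp_rw [gaussMoment, hscale]
  rw [integral_const_mul, Measure.integral_comp_inv_smul volume
    (fun x => ‖x‖ ^ k * Real.exp (-b * ‖x‖ ^ 2)), abs_of_pos (by positivity), smul_eq_mul, pow_add,
    mul_left_comm, mul_assoc]

lemma div_mul_gaussMoment_three (K b : ℝ) {ε : ℝ} (hε : 0 < ε) :
    K / ε * gaussMoment V 3 (b / ε) = K * gaussMoment V 3 b * √ε ^ (Module.finrank ℝ V + 1) := by
  rw [gaussMoment_div 3 b hε, pow_add _ _ 3, pow_succ _ 2, Real.sq_sqrt hε.le]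
  field_simp
  ring

end GaussianMoments

section Growth

variable {V : Type*} [NormedAddCommGroup V] [InnerProductSpace ℝ V] [FiniteDimensional ℝ V]
  [MeasurableSpace V] [BorelSpace V] {J q : V → ℝ} {b β : ℝ} {m : V}

lemma integrable_norm_sub_pow_mul_exp_neg (k : ℕ) (hJ : Continuous J) (hb : 0 < b)
    (hgrowth : ∀ x, b * ‖x - m‖ ^ 2 - β ≤ J x) :
    Integrable fun x => ‖x - m‖ ^ k * Real.exp (-J x) := by
  refine ((integrable_norm_sub_pow_mul_exp k hb m).const_mul (Real.exp β)).mono' (by fun_prop)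
    (ae_of_all _ fun x => ?_)
  rw [Real.norm_of_nonneg (by positivity), mul_left_comm, ← Real.exp_add]
  gcongr
  linarith [hgrowth x]

lemma integrable_exp_neg (hJ : Continuous J) (hb : 0 < b)
    (hgrowth : ∀ x, b * ‖x - m‖ ^ 2 - β ≤ J x) : Integrable fun x => Real.exp (-J x) := by
  simpa only [pow_zero, one_mul] using integrable_norm_sub_pow_mul_exp_neg 0 hJ hb hgrowth

lemma integrable_exp_neg_mul_of_abs_le (hJ : Continuous J) (hb : 0 < b)
    (hgrowth : ∀ x, b * ‖x - m‖ ^ 2 - β ≤ J x) (hq : Continuous q) {M : ℝ}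
    (hquad : ∀ x, |q x| ≤ M * ‖x - m‖ ^ 2) : Integrable fun x => Real.exp (-J x) * q x := by
  refine ((integrable_norm_sub_pow_mul_exp_neg 2 hJ hb hgrowth).const_mul M).mono' (by fun_prop)
    (ae_of_all _ fun x => ?_)
  rw [norm_mul, Real.norm_of_nonneg (Real.exp_pos _).le, mul_comm, ← mul_assoc]
  gcongr
  exact hquad x

lemma abs_mul_exp_neg_le {k t : ℝ} (hk : 0 ≤ k) (ht : -k ≤ t) :
    |t| * Real.exp (-t) ≤ 1 + 2 * k * Real.exp k := by
  have habs : |t| ≤ t + 2 * k := abs_le'.2 ⟨by linarith, by linarith⟩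
  have hmul : t * Real.exp (-t) ≤ 1 := by
    rw [Real.exp_neg, mul_inv_le_iff₀ (Real.exp_pos t)]
    linarith [Real.add_one_le_exp t]
  calc |t| * Real.exp (-t) ≤ (t + 2 * k) * Real.exp (-t) := by gcongr
    _ = t * Real.exp (-t) + 2 * k * Real.exp (-t) := add_mul _ _ _
    _ ≤ 1 + 2 * k * Real.exp k := by gcongr; linarith

lemma integrable_exp_neg_mul_self (hJ : Continuous J) (hb : 0 < b)
    (hgrowth : ∀ x, b * ‖x - m‖ ^ 2 - β ≤ J x) : Integrable fun x => Real.exp (-J x) * J x := by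
  have hhalf : Integrable fun x => Real.exp (-(J x / 2)) :=
    integrable_exp_neg (b := b / 2) (β := β / 2) (m := m) (by fun_prop) (by positivity)
      fun x => by linarith [hgrowth x]
  refine (hhalf.const_mul (2 * (1 + 2 * |β| * Real.exp |β|))).mono' (by fun_prop)
    (ae_of_all _ fun x => ?_)
  have hlower : -|β| ≤ J x / 2 := by
    have : 0 ≤ b * ‖x - m‖ ^ 2 := by positivity
    linarith [hgrowth x, le_abs_self β, abs_nonneg β]
  calc ‖Real.exp (-J x) * J x‖
      = 2 * (|J x / 2| * Real.exp (-(J x / 2))) * Real.exp (-(J x / 2)) := by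
        rw [norm_mul, Real.norm_eq_abs, Real.norm_eq_abs, Real.abs_exp, abs_div, abs_two,
          show -J x = -(J x / 2) + -(J x / 2) by ring, Real.exp_add]
        ring
    _ ≤ _ := by
        gcongr
        exact abs_mul_exp_neg_le (abs_nonneg β) hlower

end Growth

section LaplaceEstimate

lemma log_div_le_two_mul {z w t : ℝ} (hw : 0 < w) (ht0 : 0 ≤ t) (ht : t ≤ 1 / 2)
    (h : w * (1 - t) ≤ z) : Real.log (w / z) ≤ 2 * t := by
  have hz : 0 < z := lt_of_lt_of_le (mul_pos hw (by linarith)) h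
  have hhalf : w / 2 ≤ z := by nlinarith
  refine (Real.log_le_sub_one_of_pos (div_pos hw hz)).trans ?_
  rw [div_sub_one hz.ne', div_le_iff₀ hz]
  nlinarith

lemma eventually_exp_neg_div_le_rpow {δ : ℝ} (hδ : 0 < δ) (p : ℝ) :
    ∀ᶠ ε in 𝓝[>] (0 : ℝ), Real.exp (-(δ / ε)) ≤ ε ^ p := by
  have hdecay := (isLittleO_exp_neg_mul_rpow_atTop hδ (-p)).comp_tendsto tendsto_inv_nhdsGT_zero
  filter_upwards [hdecay.bound one_pos, self_mem_nhdsWithin] with ε hε hpos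
  have hpos : 0 < ε := hpos
  simpa [Real.abs_rpow_of_nonneg, Real.inv_rpow, Real.rpow_neg, hpos.le, abs_of_pos hpos,
    div_eq_mul_inv] using hε

/-- Constants controlling a potential `I` and its quadratic approximation `q` near a minimizer `m`:
`γ` and `M` pinch `q`, `K` bounds the cubic error on the ball of radius `r`, and outside this ball
`I` exceeds `δ` plus a Gaussian tail with parameters `b`, `β`. The radius is so small that on the
ball the cubic error is dominated by half of the quadratic term. -/
structure LaplaceConstants where
  (γ M K r δ b β : ℝ)
  γ_pos : 0 < γ
  M_pos : 0 < M
  K_pos : 0 < K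
  r_pos : 0 < r
  δ_pos : 0 < δ
  b_pos : 0 < b
  K_mul_r_le : K * r ≤ γ / 2

/-- `I` is a potential well at `m` for which Laplace's method with quadratic approximation `q` and
noise level `ε` works with the constants `κ`. Only the Gaussian tail depends on `ε`: it comes from
the prior, which enters the potential with weight `ε`. -/
structure IsLaplaceWell {V : Type*} [SeminormedAddCommGroup V] (κ : LaplaceConstants) (ε : ℝ)
    (I q : V → ℝ) (m : V) : Prop where
  nonneg : ∀ x, 0 ≤ I x
  le_quad : ∀ x, κ.γ * ‖x - m‖ ^ 2 ≤ q x
  quad_le : ∀ x, q x ≤ κ.M * ‖x - m‖ ^ 2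
  abs_sub_le : ∀ x ∈ Metric.ball m κ.r, |I x - q x| ≤ κ.K * ‖x - m‖ ^ 3
  tail : ∀ x ∉ Metric.ball m κ.r, κ.δ + ε * (κ.b * ‖x - m‖ ^ 2 - κ.β) ≤ I x

namespace LaplaceConstants

variable (V : Type*) [NormedAddCommGroup V] [InnerProductSpace ℝ V] [FiniteDimensional ℝ V]
  [MeasurableSpace V] [BorelSpace V] (κ : LaplaceConstants)

/-- The relative error of the normalizing constant of `exp (-(I / ε))`, in units of `√ε`. -/
noncomputable def normalizerRate : ℝ :=
  κ.K * gaussMoment V 3 κ.γ / gaussMoment V 0 κ.M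

/-- The mean of `(q - I) / ε` under the Gibbs measure of `I / ε`, in units of `√ε` and up to the
error of the normalizing constant. -/
noncomputable def remainderRate : ℝ :=
  (κ.K * gaussMoment V 3 (κ.γ / 2) + κ.M * Real.exp κ.β * gaussMoment V 2 κ.b) /
    gaussMoment V 0 κ.M

lemma normalizerRate_nonneg : 0 ≤ κ.normalizerRate V :=
  div_nonneg (mul_nonneg κ.K_pos.le (gaussMoment_nonneg _ _)) (gaussMoment_nonneg _ _)

lemma remainderRate_nonneg : 0 ≤ κ.remainderRate V :=
  div_nonneg (add_nonneg (mul_nonneg κ.K_pos.le (gaussMoment_nonneg _ _))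
    (mul_nonneg (mul_nonneg κ.M_pos.le (Real.exp_pos _).le) (gaussMoment_nonneg _ _)))
    (gaussMoment_nonneg _ _)

end LaplaceConstants

namespace IsLaplaceWell

section Pointwise

variable {V : Type*} [SeminormedAddCommGroup V] {κ : LaplaceConstants} {ε : ℝ} {I q : V → ℝ}
  {m : V}

lemma half_mul_sq_le (h : IsLaplaceWell κ ε I q m) {x : V} (hx : x ∈ Metric.ball m κ.r) :
    κ.γ / 2 * ‖x - m‖ ^ 2 ≤ I x := by
  have hcubic : κ.K * ‖x - m‖ ^ 3 ≤ κ.γ / 2 * ‖x - m‖ ^ 2 :=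
    calc κ.K * ‖x - m‖ ^ 3 = κ.K * ‖x - m‖ * ‖x - m‖ ^ 2 := by ring
      _ ≤ κ.K * κ.r * ‖x - m‖ ^ 2 := by
        have := κ.K_pos
        gcongr
        exact (mem_ball_iff_norm.1 hx).le
      _ ≤ κ.γ / 2 * ‖x - m‖ ^ 2 := by gcongr; exact κ.K_mul_r_le
  linarith [h.le_quad x, neg_le_of_abs_le (h.abs_sub_le x hx)]

lemma exp_quad_sub_le_exp (h : IsLaplaceWell κ ε I q m) (hε : 0 < ε) (hεr : ε ≤ κ.K * κ.r ^ 3)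
    (x : V) :
    Real.exp (-(q x / ε)) - κ.K / ε * (‖x - m‖ ^ 3 * Real.exp (-(κ.γ / ε) * ‖x - m‖ ^ 2)) ≤
      Real.exp (-(I x / ε)) := by
  have hK := κ.K_pos
  have hquad : Real.exp (-(q x / ε)) ≤ Real.exp (-(κ.γ / ε) * ‖x - m‖ ^ 2) := by
    rw [Real.exp_le_exp, neg_mul, neg_le_neg_iff, div_mul_eq_mul_div]
    gcongr
    exact h.le_quad x
  set E := Real.exp (-(κ.γ / ε) * ‖x - m‖ ^ 2)
  by_cases hx : x ∈ Metric.ball m κ.r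
  · have hdiff : (I x - q x) / ε ≤ κ.K / ε * ‖x - m‖ ^ 3 := by
      rw [div_mul_eq_mul_div]
      gcongr
      exact (le_abs_self _).trans (h.abs_sub_le x hx)
    calc Real.exp (-(q x / ε)) - κ.K / ε * (‖x - m‖ ^ 3 * E)
        ≤ Real.exp (-(q x / ε)) - κ.K / ε * ‖x - m‖ ^ 3 * Real.exp (-(q x / ε)) := by
          rw [← mul_assoc]
          gcongr
      _ ≤ Real.exp (-(q x / ε)) * (1 - (I x - q x) / ε) := by
          rw [mul_one_sub, mul_comm (Real.exp _) (_ / _)]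
          gcongr
      _ ≤ Real.exp (-(q x / ε)) * Real.exp (-((I x - q x) / ε)) := by
          gcongr
          exact Real.one_sub_le_exp_neg _
      _ = Real.exp (-(I x / ε)) := by
          rw [← Real.exp_add]
          ring_nf
  · have hr : κ.r ≤ ‖x - m‖ := le_of_not_gt (mt mem_ball_iff_norm.2 hx)
    have hone : 1 ≤ κ.K / ε * ‖x - m‖ ^ 3 := by
      rw [div_mul_eq_mul_div, one_le_div hε]
      have := κ.r_pos
      exact hεr.trans (by gcongr)
    have hE : E ≤ κ.K / ε * ‖x - m‖ ^ 3 * E := le_mul_of_one_le_left (Real.exp_pos _).le hone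
    rw [← mul_assoc]
    linarith [Real.exp_pos (-(I x / ε))]

lemma exp_mul_remainder_le (h : IsLaplaceWell κ ε I q m) (hε : 0 < ε) (x : V) :
    Real.exp (-(I x / ε)) * ((q x - I x) / ε) ≤
      κ.K / ε * (‖x - m‖ ^ 3 * Real.exp (-(κ.γ / 2 / ε) * ‖x - m‖ ^ 2)) +
        κ.M * Real.exp κ.β * (Real.exp (-(κ.δ / ε)) / ε) *
          (‖x - m‖ ^ 2 * Real.exp (-κ.b * ‖x - m‖ ^ 2)) := by
  have hK := κ.K_pos
  have hM := κ.M_pos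
  by_cases hx : x ∈ Metric.ball m κ.r
  · refine le_add_of_le_of_nonneg ?_ (by positivity)
    have hcubic : q x - I x ≤ κ.K * ‖x - m‖ ^ 3 := by
      linarith [neg_le_of_abs_le (h.abs_sub_le x hx)]
    calc Real.exp (-(I x / ε)) * ((q x - I x) / ε)
        ≤ Real.exp (-(I x / ε)) * (κ.K * ‖x - m‖ ^ 3 / ε) := by gcongr
      _ ≤ Real.exp (-(κ.γ / 2 * ‖x - m‖ ^ 2 / ε)) * (κ.K * ‖x - m‖ ^ 3 / ε) := by
          gcongr
          exact h.half_mul_sq_le hx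
      _ = _ := by ring_nf
  · refine le_add_of_nonneg_of_le (by positivity) ?_
    have htail : (κ.δ + ε * (κ.b * ‖x - m‖ ^ 2 - κ.β)) / ε ≤ I x / ε := by
      gcongr
      exact h.tail x hx
    rw [add_div, mul_div_cancel_left₀ _ hε.ne'] at htail
    calc Real.exp (-(I x / ε)) * ((q x - I x) / ε)
        ≤ Real.exp (-(I x / ε)) * (κ.M * ‖x - m‖ ^ 2 / ε) := by
          gcongr
          linarith [h.quad_le x, h.nonneg x]
      _ ≤ Real.exp (κ.β + -(κ.δ / ε) + -κ.b * ‖x - m‖ ^ 2) * (κ.M * ‖x - m‖ ^ 2 / ε) := by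
          gcongr
          linarith
      _ = _ := by
          rw [Real.exp_add, Real.exp_add]
          ring

end Pointwise

variable {V : Type*} [NormedAddCommGroup V] [InnerProductSpace ℝ V] [FiniteDimensional ℝ V]
  [MeasurableSpace V] [BorelSpace V] {κ : LaplaceConstants} {ε : ℝ} {I q : V → ℝ} {m : V}

lemma sqrt_pow_mul_gaussMoment_le_integral (h : IsLaplaceWell κ ε I q m) (hε : 0 < ε)
    (hq : Integrable fun x => Real.exp (-(q x / ε))) :
    √ε ^ Module.finrank ℝ V * gaussMoment V 0 κ.M ≤ ∫ x, Real.exp (-(q x / ε)) := by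
  have hM : 0 < κ.M / ε := div_pos κ.M_pos hε
  rw [← add_zero (Module.finrank ℝ V), ← gaussMoment_div 0 _ hε,
    ← integral_norm_sub_pow_mul_exp 0 _ m]
  refine integral_mono (integrable_norm_sub_pow_mul_exp 0 hM m) hq fun x => ?_
  simp only [pow_zero, one_mul, Real.exp_le_exp, neg_mul, neg_le_neg_iff, div_mul_eq_mul_div]
  gcongr
  exact h.quad_le x

lemma integral_exp_quad_sub_le_integral_exp (h : IsLaplaceWell κ ε I q m) (hε : 0 < ε)
    (hεr : ε ≤ κ.K * κ.r ^ 3) (hI : Integrable fun x => Real.exp (-(I x / ε)))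
    (hq : Integrable fun x => Real.exp (-(q x / ε))) :
    (∫ x, Real.exp (-(q x / ε))) -
        κ.K * gaussMoment V 3 κ.γ * √ε ^ (Module.finrank ℝ V + 1) ≤
      ∫ x, Real.exp (-(I x / ε)) := by
  have hcubic := (integrable_norm_sub_pow_mul_exp 3 (div_pos κ.γ_pos hε) m).const_mul (κ.K / ε)
  have hmono := integral_mono (hq.sub hcubic) hI (h.exp_quad_sub_le_exp hε hεr)
  rw [integral_sub' hq hcubic, integral_const_mul, integral_norm_sub_pow_mul_exp,
    div_mul_gaussMoment_three _ _ hε] at hmono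
  exact hmono

lemma integral_exp_mul_remainder_le (h : IsLaplaceWell κ ε I q m) (hε : 0 < ε)
    (hδ : Real.exp (-(κ.δ / ε)) ≤ ε * √ε ^ (Module.finrank ℝ V + 1))
    (hint : Integrable fun x => Real.exp (-(I x / ε)) * ((q x - I x) / ε)) :
    ∫ x, Real.exp (-(I x / ε)) * ((q x - I x) / ε) ≤
      (κ.K * gaussMoment V 3 (κ.γ / 2) + κ.M * Real.exp κ.β * gaussMoment V 2 κ.b) *
        √ε ^ (Module.finrank ℝ V + 1) := by
  have hγ : 0 < κ.γ / 2 := half_pos κ.γ_pos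
  have hM := κ.M_pos
  have hcubic := (integrable_norm_sub_pow_mul_exp 3 (div_pos hγ hε) m).const_mul (κ.K / ε)
  have htail := (integrable_norm_sub_pow_mul_exp 2 κ.b_pos m).const_mul
    (κ.M * Real.exp κ.β * (Real.exp (-(κ.δ / ε)) / ε))
  have hmono := integral_mono hint (hcubic.add htail) (h.exp_mul_remainder_le hε)
  rw [integral_add' hcubic htail, integral_const_mul, integral_const_mul,
    integral_norm_sub_pow_mul_exp, integral_norm_sub_pow_mul_exp, div_mul_gaussMoment_three _ _ hε]
    at hmono
  have hsmall : Real.exp (-(κ.δ / ε)) / ε ≤ √ε ^ (Module.finrank ℝ V + 1) :=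
    (div_le_iff₀' hε).2 hδ
  refine hmono.trans ?_
  rw [add_mul, mul_right_comm (κ.M * _)]
  gcongr
  exact mul_nonneg (by positivity) (gaussMoment_nonneg 2 κ.b)

lemma integral_exp_quad_mul_one_sub_le (h : IsLaplaceWell κ ε I q m) (hε : 0 < ε)
    (hεr : ε ≤ κ.K * κ.r ^ 3) (hI : Integrable fun x => Real.exp (-(I x / ε)))
    (hq : Integrable fun x => Real.exp (-(q x / ε))) :
    (∫ x, Real.exp (-(q x / ε))) * (1 - κ.normalizerRate V * √ε) ≤
      ∫ x, Real.exp (-(I x / ε)) := by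
  have hG := gaussMoment_zero_pos (V := V) κ.M_pos
  have hrate : κ.K * gaussMoment V 3 κ.γ * √ε ^ (Module.finrank ℝ V + 1) ≤
      (∫ x, Real.exp (-(q x / ε))) * (κ.normalizerRate V * √ε) :=
    calc κ.K * gaussMoment V 3 κ.γ * √ε ^ (Module.finrank ℝ V + 1)
        = √ε ^ Module.finrank ℝ V * gaussMoment V 0 κ.M * (κ.normalizerRate V * √ε) := by
          rw [LaplaceConstants.normalizerRate, pow_succ]
          field_simp
      _ ≤ _ := mul_le_mul_of_nonneg_right (h.sqrt_pow_mul_gaussMoment_le_integral hε hq)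
          (mul_nonneg (κ.normalizerRate_nonneg V) (Real.sqrt_nonneg ε))
  rw [mul_one_sub]
  linarith [h.integral_exp_quad_sub_le_integral_exp hε hεr hI hq]

lemma integral_tilted_remainder_le (h : IsLaplaceWell κ ε I q m) (hε : 0 < ε)
    (hεr : ε ≤ κ.K * κ.r ^ 3) (hrate : κ.normalizerRate V * √ε ≤ 1 / 2)
    (hδ : Real.exp (-(κ.δ / ε)) ≤ ε * √ε ^ (Module.finrank ℝ V + 1))
    (hI : Integrable fun x => Real.exp (-(I x / ε)))
    (hq : Integrable fun x => Real.exp (-(q x / ε)))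
    (hint : Integrable fun x => Real.exp (-(I x / ε)) * ((q x - I x) / ε)) :
    ∫ x, (q x - I x) / ε ∂(volume.tilted fun x => -(I x / ε)) ≤
      2 * (κ.remainderRate V * √ε) := by
  have hG := gaussMoment_zero_pos (V := V) κ.M_pos
  have hZ : √ε ^ Module.finrank ℝ V * gaussMoment V 0 κ.M ≤ 2 * ∫ x, Real.exp (-(I x / ε)) := by
    have hZq := h.sqrt_pow_mul_gaussMoment_le_integral hε hq
    have hZI := h.integral_exp_quad_mul_one_sub_le hε hεr hI hq
    have hZq0 : 0 < ∫ x, Real.exp (-(q x / ε)) := integral_exp_pos hq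
    nlinarith
  have hmean : ∫ x, (q x - I x) / ε ∂(volume.tilted fun x => -(I x / ε)) =
      (∫ x, Real.exp (-(I x / ε)) * ((q x - I x) / ε)) / ∫ x, Real.exp (-(I x / ε)) := by
    simp only [integral_tilted, smul_eq_mul, div_mul_eq_mul_div (Real.exp _) (∫ _, _),
      integral_div (∫ _, _)]
  rw [hmean, div_le_iff₀ (integral_exp_pos hI)]
  calc ∫ x, Real.exp (-(I x / ε)) * ((q x - I x) / ε)
      ≤ κ.remainderRate V * √ε * (√ε ^ Module.finrank ℝ V * gaussMoment V 0 κ.M) := by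
        refine (h.integral_exp_mul_remainder_le hε hδ hint).trans_eq ?_
        rw [LaplaceConstants.remainderRate, pow_succ]
        field_simp
    _ ≤ 2 * (κ.remainderRate V * √ε) * ∫ x, Real.exp (-(I x / ε)) := by
        rw [mul_comm 2, mul_assoc _ 2]
        exact mul_le_mul_of_nonneg_left hZ
          (mul_nonneg (κ.remainderRate_nonneg V) (Real.sqrt_nonneg ε))

lemma toReal_klDiv_tilted_le (h : IsLaplaceWell κ ε I q m) (hε : 0 < ε)
    (hεr : ε ≤ κ.K * κ.r ^ 3) (hrate : κ.normalizerRate V * √ε ≤ 1 / 2)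
    (hδ : Real.exp (-(κ.δ / ε)) ≤ ε * √ε ^ (Module.finrank ℝ V + 1))
    (hI : Integrable fun x => Real.exp (-(I x / ε)))
    (hq : Integrable fun x => Real.exp (-(q x / ε)))
    (hint : Integrable (fun x => (q x - I x) / ε) (volume.tilted fun x => -(I x / ε))) :
    (klDiv (volume.tilted fun x => -(I x / ε)) (volume.tilted fun x => -(q x / ε))).toReal ≤
      2 * (κ.remainderRate V + κ.normalizerRate V) * √ε := by
  have hsub (x : V) : -(I x / ε) - -(q x / ε) = (q x - I x) / ε := by ring
  rw [toReal_klDiv_tilted hI hq (by simpa only [hsub] using hint)]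
  simp only [hsub]
  rw [integrable_tilted_iff hI] at hint
  have hlog := log_div_le_two_mul (integral_exp_pos hq)
    (mul_nonneg (κ.normalizerRate_nonneg V) (Real.sqrt_nonneg ε)) hrate
    (h.integral_exp_quad_mul_one_sub_le hε hεr hI hq)
  linarith [h.integral_tilted_remainder_le hε hεr hrate hδ hI hq hint]

end IsLaplaceWell

lemma eventually_toReal_klDiv_tilted_le (V : Type*) [NormedAddCommGroup V]
    [InnerProductSpace ℝ V] [FiniteDimensional ℝ V] [MeasurableSpace V] [BorelSpace V]
    (κ : LaplaceConstants) :
    ∀ᶠ ε in 𝓝[>] (0 : ℝ), ∀ (I q : V → ℝ) (m : V), IsLaplaceWell κ ε I q m →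
      Integrable (fun x => Real.exp (-(I x / ε))) → Integrable (fun x => Real.exp (-(q x / ε))) →
      Integrable (fun x => (q x - I x) / ε) (volume.tilted fun x => -(I x / ε)) →
      (klDiv (volume.tilted fun x => -(I x / ε)) (volume.tilted fun x => -(q x / ε))).toReal ≤
        2 * (κ.remainderRate V + κ.normalizerRate V) * √ε := by
  have hr : 0 < κ.K * κ.r ^ 3 := mul_pos κ.K_pos (pow_pos κ.r_pos 3)
  have hrate : Tendsto (fun ε => κ.normalizerRate V * √ε) (𝓝[>] 0) (𝓝 0) := by
    have hcont : Continuous fun ε => κ.normalizerRate V * √ε := by fun_prop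
    simpa using (hcont.tendsto 0).mono_left nhdsWithin_le_nhds
  filter_upwards [self_mem_nhdsWithin, Ioc_mem_nhdsGT hr,
    hrate.eventually_le_const one_half_pos,
    eventually_exp_neg_div_le_rpow κ.δ_pos (1 + ((Module.finrank ℝ V + 1 : ℕ) : ℝ) / 2)]
    with ε hε hεr hrate hδ I q m h hI hq hint
  have hε : 0 < ε := hε
  rw [Real.rpow_add hε, Real.rpow_one, Real.rpow_div_two_eq_sqrt _ hε.le,
    Real.rpow_natCast] at hδ
  exact h.toReal_klDiv_tilted_le hε hεr.2 hrate hδ hI hq hint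

end LaplaceEstimate

section Taylor

open scoped Nat

variable {E F : Type*} [NormedAddCommGroup E] [NormedSpace ℝ E] [NormedAddCommGroup F]
  [NormedSpace ℝ F] [CompleteSpace F] {f : E → F} {n : ℕ} {x y : E} {K : ℝ}

lemma norm_sub_taylor_le (hf : ∀ t ∈ Set.Icc (0 : ℝ) 1, ContDiffAt ℝ (n + 1) f (x + t • y))
    (hK : ∀ t ∈ Set.Icc (0 : ℝ) 1, ‖iteratedFDeriv ℝ (n + 1) f (x + t • y)‖ ≤ K) :
    ‖f (x + y) - ∑ k ∈ Finset.range (n + 1), (k ! : ℝ)⁻¹ • iteratedFDeriv ℝ k f x fun _ => y‖ ≤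
      K * ‖y‖ ^ (n + 1) / n ! := by
  have hremainder : ∀ t ∈ Set.uIoc (0 : ℝ) 1,
      ‖(1 - t) ^ n • iteratedFDeriv ℝ (n + 1) f (x + t • y) fun _ => y‖ ≤ K * ‖y‖ ^ (n + 1) := by
    intro t ht
    rw [Set.uIoc_of_le zero_le_one] at ht
    have hpow : ‖(1 - t) ^ n‖ ≤ 1 := by
      rw [norm_pow, Real.norm_of_nonneg (sub_nonneg.2 ht.2)]
      exact pow_le_one₀ (sub_nonneg.2 ht.2) (sub_le_self _ ht.1.le)
    calc ‖(1 - t) ^ n • iteratedFDeriv ℝ (n + 1) f (x + t • y) fun _ => y‖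
        ≤ 1 * (‖iteratedFDeriv ℝ (n + 1) f (x + t • y)‖ * ‖y‖ ^ (n + 1)) := by
          rw [norm_smul]
          gcongr
          simpa using (iteratedFDeriv ℝ (n + 1) f (x + t • y)).le_opNorm fun _ => y
      _ ≤ K * ‖y‖ ^ (n + 1) := by
          rw [one_mul]
          gcongr
          exact hK t (Set.Ioc_subset_Icc_self ht)
  rw [map_add_eq_sum_add_integral_iteratedFDeriv hf, add_sub_cancel_left, norm_smul, norm_inv,
    Real.norm_natCast, ← div_eq_inv_mul]
  gcongr
  simpa using intervalIntegral.norm_integral_le_of_norm_le_const hremainder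

end Taylor

section SubConstSMul

variable {E F : Type*} [NormedAddCommGroup E] [NormedSpace ℝ E] [NormedAddCommGroup F]
  [NormedSpace ℝ F] {f g : E → F} {n : ℕ} {x : E}

lemma iteratedFDeriv_sub_const_smul_apply (hf : ContDiffAt ℝ n f x) (hg : ContDiffAt ℝ n g x)
    (c : ℝ) : iteratedFDeriv ℝ n (f - c • g) x =
      iteratedFDeriv ℝ n f x - c • iteratedFDeriv ℝ n g x := by
  have hcg : ContDiffAt ℝ n (c • g) x := hg.const_smul c
  rw [iteratedFDeriv_sub_apply hf hcg, iteratedFDeriv_const_smul_apply hg]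

lemma norm_iteratedFDeriv_sub_const_smul_le (hf : ContDiffAt ℝ n f x) (hg : ContDiffAt ℝ n g x)
    (c : ℝ) : ‖iteratedFDeriv ℝ n (f - c • g) x‖ ≤
      ‖iteratedFDeriv ℝ n f x‖ + |c| * ‖iteratedFDeriv ℝ n g x‖ := by
  rw [iteratedFDeriv_sub_const_smul_apply hf hg, ← Real.norm_eq_abs, ← norm_smul]
  exact norm_sub_le _ _

end SubConstSMul

section Hessian

variable {d : ℕ} {f g : EuclideanSpace ℝ (Fin d) → ℝ} {m x : EuclideanSpace ℝ (Fin d)}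

lemma quadForm_hessian (f : EuclideanSpace ℝ (Fin d) → ℝ) (x v : EuclideanSpace ℝ (Fin d)) :
    quadForm (hessian f x) v = iteratedFDeriv ℝ 2 f x fun _ => v := by
  have hcoord := LinearMap.BilinForm.apply_eq_dotProduct_toMatrix_mulVec
    (EuclideanSpace.basisFun (Fin d) ℝ).toBasis (fderiv ℝ (fderiv ℝ f) x).toLinearMap₁₂ v v
  rw [iteratedFDeriv_two_apply]
  refine Eq.trans ?_ hcoord.symm
  simp only [quadForm]
  congr 2
  ext i j
  simp [hessian, LinearMap.BilinForm.toMatrix_apply, iteratedFDeriv_two_apply]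

lemma hessian_sub_const_smul (hf : ContDiffAt ℝ 2 f x) (hg : ContDiffAt ℝ 2 g x) (c : ℝ) :
    hessian (f - c • g) x = hessian f x - c • hessian g x := by
  ext i j
  simp [hessian, iteratedFDeriv_sub_const_smul_apply (n := 2) hf hg]

lemma continuous_hessian (hf : ContDiff ℝ 2 f) : Continuous (hessian f) := by
  have := hf.continuous_iteratedFDeriv (m := 2) le_rfl
  refine continuous_matrix fun i j => ?_
  simp only [hessian, Matrix.of_apply]
  fun_prop

lemma abs_sub_half_quadForm_hessian_le (hf : ContDiff ℝ 3 f) (hm : IsLocalMin f m)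
    (hm0 : f m = 0) {K ρ : ℝ} (hK : ∀ z ∈ Metric.ball m ρ, ‖iteratedFDeriv ℝ 3 f z‖ ≤ K)
    (hx : x ∈ Metric.ball m ρ) :
    |f x - 1 / 2 * quadForm (hessian f m) (x - m)| ≤ K * ‖x - m‖ ^ 3 / 2 := by
  have hsegment : ∀ t ∈ Set.Icc (0 : ℝ) 1, m + t • (x - m) ∈ Metric.ball m ρ := fun t ht =>
    (convex_ball m ρ).add_smul_sub_mem (Metric.mem_ball_self (Metric.pos_of_mem_ball hx)) hx ht
  have htaylor := norm_sub_taylor_le (n := 2) (x := m) (y := x - m) (fun t _ => hf.contDiffAt)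
    fun t ht => hK _ (hsegment t ht)
  simpa [Finset.sum_range_succ, hm0, hm.fderiv_eq_zero, quadForm_hessian] using htaylor

end Hessian

section Posterior

variable {d : ℕ} {prior φ : EuclideanSpace ℝ (Fin d) → ℝ} {ε : ℝ}
  {m : EuclideanSpace ℝ (Fin d)}

lemma IsPriorDensity.exp_log (hprior : IsPriorDensity prior) :
    (fun x => Real.exp (Real.log (prior x))) = prior :=
  funext fun x => Real.exp_log (hprior.pos x)

lemma IsPriorDensity.integrable (hprior : IsPriorDensity prior) : Integrable prior :=
  .of_integral_ne_zero (by simp [hprior.integral_eq_one])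

lemma IsPriorDensity.exists_log_le (hprior : IsPriorDensity prior) :
    ∃ a α : ℝ, 0 < a ∧ ∀ m x, Real.log (prior x) ≤ α + 2 * a * ‖m‖ ^ 2 - a * ‖x - m‖ ^ 2 := by
  obtain ⟨A, a, ha, htail⟩ := hprior.gaussian_tail
  refine ⟨a / 2, Real.log A, half_pos ha, fun m x => ?_⟩
  have hA : 0 < A := pos_of_mul_pos_left ((hprior.pos x).trans_le (htail x)) (Real.exp_pos _).le
  have hlog := Real.log_le_log (hprior.pos x) (htail x)
  rw [Real.log_mul hA.ne' (Real.exp_ne_zero _), Real.log_exp] at hlog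
  have hnorm : ‖x - m‖ ^ 2 ≤ 2 * ‖m‖ ^ 2 + 2 * ‖x‖ ^ 2 := by
    have := parallelogram_law_with_norm ℝ x m
    nlinarith [sq_nonneg ‖x + m‖]
  linarith [mul_le_mul_of_nonneg_left hnorm ha.le]

lemma priorMeasure_eq_tilted (hprior : IsPriorDensity prior) :
    priorMeasure prior = volume.tilted fun x => Real.log (prior x) := by
  simp only [priorMeasure, Measure.tilted, hprior.integral_eq_one, div_one,
    Real.exp_log (hprior.pos _)]

lemma neg_regPotential_div (hε : ε ≠ 0) (x : EuclideanSpace ℝ (Fin d)) :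
    -(regPotential prior φ ε x / ε) = Real.log (prior x) + -(1 / ε) * φ x := by
  rw [regPotential]
  field_simp
  ring

lemma posterior_eq_tilted (hprior : IsPriorDensity prior) (hε : ε ≠ 0) :
    posterior prior φ ε = volume.tilted fun x => -(regPotential prior φ ε x / ε) := by
  have hint : Integrable fun x => Real.exp (Real.log (prior x)) :=
    hprior.exp_log.symm ▸ hprior.integrable
  rw [posterior, priorMeasure_eq_tilted hprior, tilted_tilted hint]
  simp only [neg_regPotential_div hε]
  rfl

/-- The second order Taylor polynomial of `I_ε` at a zero `m` of `I_ε` and of its gradient. -/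
noncomputable def quadApprox (prior φ : EuclideanSpace ℝ (Fin d) → ℝ) (ε : ℝ)
    (m x : EuclideanSpace ℝ (Fin d)) : ℝ :=
  1 / 2 * quadForm (hessian (regPotential prior φ ε) m) (x - m)

lemma quadForm_inv_smul_laplaceCov (hε : ε ≠ 0)
    (hH : (hessian (regPotential prior φ ε) m).PosDef) (x : EuclideanSpace ℝ (Fin d)) :
    -(1 / 2) * quadForm (ε • laplaceCov prior φ ε m)⁻¹ (x - m) =
      -(quadApprox prior φ ε m x / ε) := by
  have hinv : (ε • laplaceCov prior φ ε m)⁻¹ = ε⁻¹ • hessian (regPotential prior φ ε) m := by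
    have := invertibleOfNonzero hε
    rw [laplaceCov, Matrix.inv_smul _ _ hH.inv.det_pos.ne'.isUnit,
      Matrix.nonsing_inv_nonsing_inv _ hH.det_pos.ne'.isUnit, invOf_eq_inv]
  rw [hinv, quadForm_smul_left, quadApprox]
  ring

lemma posDef_smul_laplaceCov (hε : 0 < ε) (hH : (hessian (regPotential prior φ ε) m).PosDef) :
    (ε • laplaceCov prior φ ε m).PosDef :=
  hH.inv.smul hε

lemma laplaceApprox_eq_tilted (hε : 0 < ε)
    (hH : (hessian (regPotential prior φ ε) m).PosDef) :
    laplaceApprox prior φ ε m = volume.tilted fun x => -(quadApprox prior φ ε m x / ε) := by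
  rw [laplaceApprox, multivariateGaussian_eq_tilted (posDef_smul_laplaceCov hε hH)]
  simp only [quadForm_inv_smul_laplaceCov hε.ne' hH]

lemma integral_exp_neg_quadApprox_div (hε : 0 < ε)
    (hH : (hessian (regPotential prior φ ε) m).PosDef) :
    ∫ x, Real.exp (-(quadApprox prior φ ε m x / ε)) =
      ε ^ ((d : ℝ) / 2) * √(((2 * Real.pi) • laplaceCov prior φ ε m).det) := by
  simp only [← quadForm_inv_smul_laplaceCov hε.ne' hH]
  rw [integral_exp_neg_half_quadForm_inv (posDef_smul_laplaceCov hε hH), smul_comm,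
    Matrix.det_smul, Fintype.card_fin, Real.sqrt_mul (by positivity),
    Real.sqrt_eq_rpow (ε ^ d), ← Real.rpow_natCast_mul hε.le, mul_one_div]

lemma laplaceDensity_eq (hε : 0 < ε) (hH : (hessian (regPotential prior φ ε) m).PosDef)
    (x : EuclideanSpace ℝ (Fin d)) :
    laplaceDensity prior φ ε m x = Real.exp (-(quadApprox prior φ ε m x / ε)) /
      ∫ y, Real.exp (-(quadApprox prior φ ε m y / ε)) := by
  rw [integral_exp_neg_quadApprox_div hε hH, div_eq_inv_mul, laplaceDensity, quadApprox, quadForm]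
  congr 2
  ring

/-- The divergence of the posterior from its Laplace approximation. -/
noncomputable def laplaceDivergence (prior φ : EuclideanSpace ℝ (Fin d) → ℝ) (ε : ℝ)
    (m : EuclideanSpace ℝ (Fin d)) : ENNReal :=
  klDiv (posterior prior φ ε) (laplaceApprox prior φ ε m)

/-- What a single Laplace approximation needs: the potential is continuous and bounded below, and
`I_ε` has a positive definite Hessian at `m`. -/
structure IsLaplacePoint (prior φ : EuclideanSpace ℝ (Fin d) → ℝ) (ε : ℝ)
    (m : EuclideanSpace ℝ (Fin d)) : Prop where
  isPriorDensity : IsPriorDensity prior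
  continuous_prior : Continuous prior
  continuous_potential : Continuous φ
  eps_pos : 0 < ε
  bddBelow_potential : BddBelow (Set.range φ)
  hessian_posDef : (hessian (regPotential prior φ ε) m).PosDef

lemma contDiff_regPotential {n : WithTop ℕ∞} (hprior : IsPriorDensity prior)
    (hp : ContDiff ℝ n prior) (hφ : ContDiff ℝ n φ) : ContDiff ℝ n (regPotential prior φ ε) :=
  hφ.sub (contDiff_const.mul (hp.log fun x => (hprior.pos x).ne'))

lemma continuous_regPotential (hprior : IsPriorDensity prior) (hp : Continuous prior)
    (hφ : Continuous φ) : Continuous (regPotential prior φ ε) :=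
  (contDiff_regPotential hprior (contDiff_zero.2 hp) (contDiff_zero.2 hφ)).continuous

lemma continuous_quadApprox : Continuous (quadApprox prior φ ε m) :=
  continuous_const.mul ((continuous_quadForm _).comp (continuous_id.sub continuous_const))

namespace IsLaplacePoint

lemma exists_growth (h : IsLaplacePoint prior φ ε m) :
    ∃ b β : ℝ, 0 < b ∧ ∀ x, b * ‖x - m‖ ^ 2 - β ≤ regPotential prior φ ε x / ε := by
  obtain ⟨a, α, ha, hlog⟩ := h.isPriorDensity.exists_log_le
  obtain ⟨c, hc⟩ := h.bddBelow_potential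
  refine ⟨a, α + 2 * a * ‖m‖ ^ 2 - c / ε, ha, fun x => ?_⟩
  have hφ : c / ε ≤ φ x / ε := div_le_div_of_nonneg_right (hc ⟨x, rfl⟩) h.eps_pos.le
  rw [regPotential, sub_div, mul_div_cancel_left₀ _ h.eps_pos.ne']
  linarith [hlog m x]

lemma exists_quadApprox_bounds (h : IsLaplacePoint prior φ ε m) :
    ∃ b B : ℝ, 0 < b ∧ ∀ x, b * ‖x - m‖ ^ 2 ≤ quadApprox prior φ ε m x / ε ∧
      |quadApprox prior φ ε m x / ε| ≤ B * ‖x - m‖ ^ 2 := by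
  obtain ⟨γ, M, hγ, -, hbounds⟩ := exists_eventually_quadForm_bounds h.hessian_posDef
  have hε := h.eps_pos
  refine ⟨γ / 2 / ε, M / 2 / ε, by positivity, fun x => ?_⟩
  obtain ⟨hl, hu⟩ := hbounds.self_of_nhds (x - m)
  have hq : 0 ≤ quadApprox prior φ ε m x := by
    have : 0 ≤ γ * ‖x - m‖ ^ 2 := by positivity
    rw [quadApprox]
    linarith
  rw [abs_of_nonneg (by positivity), quadApprox]
  constructor
  · rw [div_mul_eq_mul_div, div_mul_eq_mul_div]
    gcongr
    linarith
  · rw [div_mul_eq_mul_div, div_mul_eq_mul_div]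
    gcongr
    linarith

lemma integrable_exp_neg_regPotential (h : IsLaplacePoint prior φ ε m) :
    Integrable fun x => Real.exp (-(regPotential prior φ ε x / ε)) := by
  obtain ⟨b, β, hb, hgrowth⟩ := h.exists_growth
  exact integrable_exp_neg
    ((continuous_regPotential h.isPriorDensity h.continuous_prior h.continuous_potential).div_const
      ε) hb hgrowth

lemma integrable_exp_neg_quadApprox (h : IsLaplacePoint prior φ ε m) :
    Integrable fun x => Real.exp (-(quadApprox prior φ ε m x / ε)) := by
  obtain ⟨b, B, hb, hbounds⟩ := h.exists_quadApprox_bounds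
  exact integrable_exp_neg (β := 0) (continuous_quadApprox.div_const ε) hb fun x => by
    simpa using (hbounds x).1

lemma integrable_sub_quadApprox (h : IsLaplacePoint prior φ ε m) :
    Integrable (fun x => -(regPotential prior φ ε x / ε) - -(quadApprox prior φ ε m x / ε))
      (volume.tilted fun x => -(regPotential prior φ ε x / ε)) := by
  obtain ⟨b, β, hb, hgrowth⟩ := h.exists_growth
  obtain ⟨_, B, -, hbounds⟩ := h.exists_quadApprox_bounds
  have hcont := (continuous_regPotential h.isPriorDensity h.continuous_prior
    h.continuous_potential (ε := ε)).div_const ε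
  have hI := integrable_exp_neg_mul_self hcont hb hgrowth
  have hq := integrable_exp_neg_mul_of_abs_le hcont hb hgrowth
    (continuous_quadApprox.div_const ε) fun x => (hbounds x).2
  rw [integrable_tilted_iff h.integrable_exp_neg_regPotential]
  refine (hq.sub hI).congr (ae_of_all _ fun x => ?_)
  simp only [Pi.sub_apply, smul_eq_mul]
  ring

lemma integrable_sub_log_prior (h : IsLaplacePoint prior φ ε m) :
    Integrable (fun x => -(regPotential prior φ ε x / ε) - Real.log (prior x))
      (volume.tilted fun x => -(regPotential prior φ ε x / ε)) := by
  obtain ⟨c, hc⟩ := h.bddBelow_potential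
  have hε := h.eps_pos
  have hφ := h.continuous_potential
  have hprior := h.continuous_prior
  obtain ⟨C, hC⟩ : ∃ C, ∀ x, |-(1 / ε) * φ x| * Real.exp (-(1 / ε) * φ x) ≤ C := by
    refine ⟨1 + 2 * (|c| / ε) * Real.exp (|c| / ε), fun x => ?_⟩
    have hge : -(|c| / ε) ≤ φ x / ε := by
      rw [← neg_div]
      gcongr
      exact (neg_abs_le c).trans (hc ⟨x, rfl⟩)
    rw [neg_mul, one_div_mul_eq_div, abs_neg]
    exact abs_mul_exp_neg_le (by positivity) hge
  rw [integrable_tilted_iff h.integrable_exp_neg_regPotential]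
  simp only [neg_regPotential_div hε.ne', Real.exp_add, Real.exp_log (h.isPriorDensity.pos _),
    add_sub_cancel_left, smul_eq_mul]
  refine (h.isPriorDensity.integrable.mul_const C).mono' (by fun_prop) (ae_of_all _ fun x => ?_)
  rw [Real.norm_eq_abs, abs_mul, abs_mul, abs_of_pos (h.isPriorDensity.pos x), Real.abs_exp,
    mul_assoc, mul_comm (Real.exp _)]
  exact mul_le_mul_of_nonneg_left (hC x) (h.isPriorDensity.pos x).le

lemma laplaceDivergence_ne_top (h : IsLaplacePoint prior φ ε m) :
    laplaceDivergence prior φ ε m ≠ ⊤ := by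
  rw [laplaceDivergence, posterior_eq_tilted h.isPriorDensity h.eps_pos.ne',
    laplaceApprox_eq_tilted h.eps_pos h.hessian_posDef]
  exact klDiv_tilted_ne_top h.integrable_exp_neg_regPotential h.integrable_exp_neg_quadApprox
    h.integrable_sub_quadApprox

lemma laplaceGain_eq_sub (h : IsLaplacePoint prior φ ε m) :
    laplaceGain prior φ ε m = (klDiv (posterior prior φ ε) (priorMeasure prior)).toReal -
      (laplaceDivergence prior φ ε m).toReal := by
  have hlog := h.isPriorDensity.exp_log
  have hgain := integral_log_density_div_density_tilted h.integrable_exp_neg_regPotential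
    h.integrable_exp_neg_quadApprox (hlog.symm ▸ h.isPriorDensity.integrable)
    h.integrable_sub_quadApprox h.integrable_sub_log_prior
  simp only [Real.exp_log (h.isPriorDensity.pos _), h.isPriorDensity.integral_eq_one, div_one,
    ← laplaceDensity_eq h.eps_pos h.hessian_posDef] at hgain
  rw [laplaceGain, laplaceDivergence, posterior_eq_tilted h.isPriorDensity h.eps_pos.ne',
    laplaceApprox_eq_tilted h.eps_pos h.hessian_posDef, priorMeasure_eq_tilted h.isPriorDensity,
    hgain]

end IsLaplacePoint

end Posterior

section Asymptotics

variable {d : ℕ} {prior : EuclideanSpace ℝ (Fin d) → ℝ} {ε ε₀ : ℝ}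
  {Φ : ℝ → EuclideanSpace ℝ (Fin d) → ℝ} {u : ℝ → EuclideanSpace ℝ (Fin d)}

/-- Assumptions on the potentials `Φ ε` and the zeros `u ε` of `I_ε ≥ 0` in which no limit as
`ε → 0` is required to exist: the points `u ε` are only bounded, the Hessians of `I_ε` at `u ε` are
only pinched between two multiples of the identity, and third derivatives are only bounded near
`u ε`. -/
structure IsUniformLaplaceFamily (ε₀ : ℝ) (prior : EuclideanSpace ℝ (Fin d) → ℝ)
    (Φ : ℝ → EuclideanSpace ℝ (Fin d) → ℝ) (u : ℝ → EuclideanSpace ℝ (Fin d)) : Prop where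
  contDiff_prior : ContDiff ℝ 3 prior
  contDiff_potential : ∀ ε, 0 < ε → ε ≤ ε₀ → ContDiff ℝ 3 (Φ ε)
  uniformlyBoundedBelow : UniformlyBoundedBelow ε₀ Φ
  nonneg : ∀ ε, 0 < ε → ε ≤ ε₀ → ∀ x, 0 ≤ regPotential prior (Φ ε) ε x
  eq_zero : ∀ ε, 0 < ε → ε ≤ ε₀ → regPotential prior (Φ ε) ε (u ε) = 0
  hessian_posDef : ∀ ε, 0 < ε → ε ≤ ε₀ → (hessian (regPotential prior (Φ ε) ε) (u ε)).PosDef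
  eventually_norm_le : ∃ R, ∀ᶠ ε in 𝓝[>] (0 : ℝ), ‖u ε‖ ≤ R
  eventually_quadForm_bounds : ∃ γ M, 0 < γ ∧ 0 < M ∧ ∀ᶠ ε in 𝓝[>] (0 : ℝ), ∀ v,
    γ * ‖v‖ ^ 2 ≤ quadForm (hessian (regPotential prior (Φ ε) ε) (u ε)) v ∧
      quadForm (hessian (regPotential prior (Φ ε) ε) (u ε)) v ≤ M * ‖v‖ ^ 2
  eventually_separated : ∀ r, 0 < r → ∃ δ, 0 < δ ∧ ∀ᶠ ε in 𝓝[>] (0 : ℝ),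
    ∀ x ∉ Metric.ball (u ε) r, δ ≤ regPotential prior (Φ ε) ε x
  eventually_norm_iteratedFDeriv_le : ∃ ρ K, 0 < ρ ∧ ∀ᶠ ε in 𝓝[>] (0 : ℝ),
    ∀ x ∈ Metric.ball (u ε) ρ, ‖iteratedFDeriv ℝ 3 (regPotential prior (Φ ε) ε) x‖ ≤ K

/-- The factor `δ / (2 * (δ + c))` is the weight of the bound `hT` for which its convex combination
with `hI` retains `δ / 2`. -/
lemma half_add_mul_le_of_le {I δ c ε T : ℝ} (hδ : 0 < δ) (hc : 0 ≤ c) (hI : δ ≤ I)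
    (hT : ε * T - c ≤ I) : δ / 2 + ε * (δ / (2 * (δ + c)) * T) ≤ I := by
  set θ := δ / (2 * (δ + c)) with hθ
  have : 0 ≤ θ := by positivity
  have hθ1 : θ ≤ 1 := by
    rw [hθ, div_le_one (by positivity)]
    linarith
  have hθc : θ * (δ + c) = δ / 2 := by
    rw [hθ]
    field_simp
  calc δ / 2 + ε * (θ * T) = (1 - θ) * δ + θ * (ε * T - c) := by linear_combination hθc
    _ ≤ (1 - θ) * I + θ * I := by
      have := sub_nonneg.mpr hθ1
      gcongr
    _ = I := by ring

namespace IsUniformLaplaceFamily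

lemma isLaplacePoint (h : IsUniformLaplaceFamily ε₀ prior Φ u) (hprior : IsPriorDensity prior)
    (hε : 0 < ε) (hε' : ε ≤ ε₀) : IsLaplacePoint prior (Φ ε) ε (u ε) where
  isPriorDensity := hprior
  continuous_prior := h.contDiff_prior.continuous
  continuous_potential := (h.contDiff_potential ε hε hε').continuous
  eps_pos := hε
  bddBelow_potential := by
    obtain ⟨c, hc⟩ := h.uniformlyBoundedBelow
    exact ⟨-c, Set.forall_mem_range.mpr (hc ε hε hε')⟩
  hessian_posDef := h.hessian_posDef ε hε hε'

lemma exists_eventually_quadApprox_bounds (h : IsUniformLaplaceFamily ε₀ prior Φ u) :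
    ∃ γ M, 0 < γ ∧ 0 < M ∧ ∀ᶠ ε in 𝓝[>] (0 : ℝ), ∀ x,
      γ * ‖x - u ε‖ ^ 2 ≤ quadApprox prior (Φ ε) ε (u ε) x ∧
        quadApprox prior (Φ ε) ε (u ε) x ≤ M * ‖x - u ε‖ ^ 2 := by
  obtain ⟨γ, M, hγ, hM, hbounds⟩ := h.eventually_quadForm_bounds
  refine ⟨γ / 2, M / 2, half_pos hγ, half_pos hM, hbounds.mono fun ε hε x => ?_⟩
  obtain ⟨hl, hu⟩ := hε (x - u ε)
  rw [quadApprox]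
  constructor <;> linarith

lemma exists_eventually_abs_sub_quadApprox_le (h : IsUniformLaplaceFamily ε₀ prior Φ u)
    (hprior : IsPriorDensity prior) (hε₀ : 0 < ε₀) :
    ∃ ρ K, 0 < ρ ∧ 0 < K ∧ ∀ᶠ ε in 𝓝[>] (0 : ℝ), ∀ x ∈ Metric.ball (u ε) ρ,
      |regPotential prior (Φ ε) ε x - quadApprox prior (Φ ε) ε (u ε) x| ≤
        K * ‖x - u ε‖ ^ 3 := by
  obtain ⟨ρ, K, hρ, hK⟩ := h.eventually_norm_iteratedFDeriv_le
  refine ⟨ρ, |K| + 1, hρ, by positivity, ?_⟩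
  filter_upwards [hK, Ioc_mem_nhdsGT hε₀] with ε hK ⟨hε, hε'⟩ x hx
  have hmin : IsLocalMin (regPotential prior (Φ ε) ε) (u ε) := Eventually.of_forall fun y =>
    (h.eq_zero ε hε hε').trans_le (h.nonneg ε hε hε' y)
  refine (abs_sub_half_quadForm_hessian_le (contDiff_regPotential hprior h.contDiff_prior
    (h.contDiff_potential ε hε hε')) hmin (h.eq_zero ε hε hε') hK hx).trans ?_
  rw [mul_div_right_comm]
  gcongr
  linarith [le_abs_self K, abs_nonneg K]

lemma exists_eventually_tail_le (h : IsUniformLaplaceFamily ε₀ prior Φ u)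
    (hprior : IsPriorDensity prior) (hε₀ : 0 < ε₀) {r : ℝ} (hr : 0 < r) :
    ∃ δ b β, 0 < δ ∧ 0 < b ∧ ∀ᶠ ε in 𝓝[>] (0 : ℝ), ∀ x ∉ Metric.ball (u ε) r,
      δ + ε * (b * ‖x - u ε‖ ^ 2 - β) ≤ regPotential prior (Φ ε) ε x := by
  obtain ⟨a, α, ha, hlog⟩ := hprior.exists_log_le
  obtain ⟨c, hc⟩ := h.uniformlyBoundedBelow
  obtain ⟨R, hR⟩ := h.eventually_norm_le
  obtain ⟨δ, hδ, hsep⟩ := h.eventually_separated r hr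
  set θ := δ / (2 * (δ + |c|)) with hθ
  refine ⟨δ / 2, θ * a, θ * (α + 2 * a * R ^ 2), half_pos hδ, by positivity, ?_⟩
  filter_upwards [hR, hsep, Ioc_mem_nhdsGT hε₀] with ε hR hsep ⟨hε, hε'⟩ x hx
  have hgrowth : ε * (a * ‖x - u ε‖ ^ 2 - (α + 2 * a * R ^ 2)) - |c| ≤
      regPotential prior (Φ ε) ε x := by
    have hR2 : a * ‖u ε‖ ^ 2 ≤ a * R ^ 2 := by gcongr
    have hprior_le : ε * Real.log (prior x) ≤
        ε * (α + 2 * a * R ^ 2 - a * ‖x - u ε‖ ^ 2) := by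
      gcongr
      linarith [hlog (u ε) x]
    rw [regPotential]
    linarith [hc ε hε hε' x, le_abs_self c]
  convert half_add_mul_le_of_le hδ (abs_nonneg c) (hsep x hx) hgrowth using 3
  rw [← hθ]
  ring

lemma exists_eventually_isLaplaceWell (h : IsUniformLaplaceFamily ε₀ prior Φ u)
    (hprior : IsPriorDensity prior) (hε₀ : 0 < ε₀) :
    ∃ κ, ∀ᶠ ε in 𝓝[>] (0 : ℝ), IsLaplaceWell κ ε (regPotential prior (Φ ε) ε)
      (quadApprox prior (Φ ε) ε (u ε)) (u ε) := by
  obtain ⟨γ, M, hγ, hM, hquad⟩ := h.exists_eventually_quadApprox_bounds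
  obtain ⟨ρ, K, hρ, hK, hcubic⟩ := h.exists_eventually_abs_sub_quadApprox_le hprior hε₀
  set r := min ρ (γ / 2 / K)
  have hr_pos : 0 < r := by positivity
  have hKr : K * r ≤ γ / 2 := (le_div_iff₀' hK).mp (min_le_right _ _)
  obtain ⟨δ, b, β, hδ, hb, htail⟩ := h.exists_eventually_tail_le hprior hε₀ hr_pos
  refine ⟨⟨γ, M, K, r, δ, b, β, hγ, hM, hK, hr_pos, hδ, hb, hKr⟩, ?_⟩
  filter_upwards [hquad, hcubic, htail, Ioc_mem_nhdsGT hε₀] with ε hquad hcubic htail ⟨hε, hε'⟩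
  exact
    { nonneg := h.nonneg ε hε hε'
      le_quad := fun x => (hquad x).1
      quad_le := fun x => (hquad x).2
      abs_sub_le := fun x hx => hcubic x (Metric.ball_subset_ball (min_le_left _ _) hx)
      tail := htail }

theorem laplaceDivergence_isBigO (h : IsUniformLaplaceFamily ε₀ prior Φ u)
    (hprior : IsPriorDensity prior) (hε₀ : 0 < ε₀) :
    (fun ε => (laplaceDivergence prior (Φ ε) ε (u ε)).toReal)
      =O[𝓝[>] (0 : ℝ)] fun ε => ε ^ ((1 : ℝ) / 2) := by
  obtain ⟨κ, hwell⟩ := h.exists_eventually_isLaplaceWell hprior hε₀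
  refine .of_bound (2 * (κ.remainderRate (EuclideanSpace ℝ (Fin d)) +
    κ.normalizerRate (EuclideanSpace ℝ (Fin d)))) ?_
  filter_upwards [hwell, eventually_toReal_klDiv_tilted_le (EuclideanSpace ℝ (Fin d)) κ,
    Ioc_mem_nhdsGT hε₀] with ε hwell hbound ⟨hε, hε'⟩
  have hpoint := h.isLaplacePoint hprior hε hε'
  rw [laplaceDivergence, posterior_eq_tilted hprior hε.ne',
    laplaceApprox_eq_tilted hε hpoint.hessian_posDef, Real.norm_of_nonneg ENNReal.toReal_nonneg,
    ← Real.sqrt_eq_rpow, Real.norm_of_nonneg (Real.sqrt_nonneg ε)]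
  refine hbound _ _ _ hwell hpoint.integrable_exp_neg_regPotential
    hpoint.integrable_exp_neg_quadApprox (hpoint.integrable_sub_quadApprox.congr ?_)
  exact ae_of_all _ fun x => by ring

lemma tendsto_laplaceDivergence (h : IsUniformLaplaceFamily ε₀ prior Φ u)
    (hprior : IsPriorDensity prior) (hε₀ : 0 < ε₀) :
    Tendsto (fun ε => (laplaceDivergence prior (Φ ε) ε (u ε)).toReal) (𝓝[>] 0) (𝓝 0) := by
  refine (h.laplaceDivergence_isBigO hprior hε₀).trans_tendsto ?_
  simpa using ((Real.continuous_rpow_const one_half_pos.le).tendsto' 0 0 (by simp)).mono_left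
    nhdsWithin_le_nhds

end IsUniformLaplaceFamily

end Asymptotics

section ExpectedInformationGain

section DominatedConvergence

variable {Ω : Type*} [MeasurableSpace Ω] {P : Measure Ω} {κ : Ω → ℝ}

lemma ae_norm_toReal_le_abs {f : Ω → ENNReal} (hf : ∀ᵐ ω ∂P, f ω ≤ ENNReal.ofReal (κ ω)) :
    ∀ᵐ ω ∂P, ‖(f ω).toReal‖ ≤ |κ ω| := by
  filter_upwards [hf] with ω hω
  rw [Real.norm_of_nonneg ENNReal.toReal_nonneg]
  exact ENNReal.toReal_le_of_le_ofReal (abs_nonneg _)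
    (hω.trans (ENNReal.ofReal_le_ofReal (le_abs_self _)))

lemma integrable_toReal_of_le_ofReal {f : Ω → ENNReal}
    (hmeas : AEStronglyMeasurable (fun ω => (f ω).toReal) P) (hκ : Integrable κ P)
    (hf : ∀ᵐ ω ∂P, f ω ≤ ENNReal.ofReal (κ ω)) : Integrable (fun ω => (f ω).toReal) P :=
  hκ.abs.mono' hmeas (ae_norm_toReal_le_abs hf)

lemma tendsto_integral_toReal_zero {ι : Type*} {l : Filter ι} [l.IsCountablyGenerated]
    {f : ι → Ω → ENNReal}
    (hmeas : ∀ᶠ i in l, AEStronglyMeasurable (fun ω => (f i ω).toReal) P) (hκ : Integrable κ P)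
    (hf : ∀ᶠ i in l, ∀ᵐ ω ∂P, f i ω ≤ ENNReal.ofReal (κ ω))
    (hlim : ∀ᵐ ω ∂P, Tendsto (fun i => (f i ω).toReal) l (𝓝 0)) :
    Tendsto (fun i => ∫ ω, (f i ω).toReal ∂P) l (𝓝 0) := by
  simpa using tendsto_integral_filter_of_dominated_convergence (fun ω => |κ ω|) hmeas
    (hf.mono fun i hi => ae_norm_toReal_le_abs hi) hκ.abs hlim

end DominatedConvergence

variable {d : ℕ} {prior : EuclideanSpace ℝ (Fin d) → ℝ} {ε : ℝ} {Y Ω : Type*}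
  [MeasurableSpace Ω] {P : Measure Ω} {y : Ω → Y} {φ : Y → EuclideanSpace ℝ (Fin d) → ℝ}
  {m : Y → EuclideanSpace ℝ (Fin d)}

lemma laplaceGain_ae_eq_sub (h : ∀ᵐ ω ∂P, IsLaplacePoint prior (φ (y ω)) ε (m (y ω))) :
    (fun ω => laplaceGain prior (φ (y ω)) ε (m (y ω))) =ᵐ[P] fun ω =>
      (klDiv (posterior prior (φ (y ω)) ε) (priorMeasure prior)).toReal -
        (laplaceDivergence prior (φ (y ω)) ε (m (y ω))).toReal :=
  h.mono fun _ hω => hω.laplaceGain_eq_sub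

lemma integrable_laplaceGain (h : ∀ᵐ ω ∂P, IsLaplacePoint prior (φ (y ω)) ε (m (y ω)))
    (hgain : Integrable
      (fun ω => (klDiv (posterior prior (φ (y ω)) ε) (priorMeasure prior)).toReal) P)
    (hdiv : Integrable (fun ω => (laplaceDivergence prior (φ (y ω)) ε (m (y ω))).toReal) P) :
    Integrable (fun ω => laplaceGain prior (φ (y ω)) ε (m (y ω))) P :=
  (hgain.sub hdiv).congr (laplaceGain_ae_eq_sub h).symm

lemma EIG_sub_EIGLaplaceLowerBound
    (h : ∀ᵐ ω ∂P, IsLaplacePoint prior (φ (y ω)) ε (m (y ω)))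
    (hgain : Integrable
      (fun ω => (klDiv (posterior prior (φ (y ω)) ε) (priorMeasure prior)).toReal) P)
    (hdiv : Integrable (fun ω => (laplaceDivergence prior (φ (y ω)) ε (m (y ω))).toReal) P) :
    EIG P prior φ y ε - EIGLaplaceLowerBound P prior φ m y ε =
      ∫ ω, (laplaceDivergence prior (φ (y ω)) ε (m (y ω))).toReal ∂P := by
  rw [EIG, EIGLaplaceLowerBound, integral_congr_ae (laplaceGain_ae_eq_sub h),
    integral_sub hgain hdiv, sub_sub_cancel]

lemma EIGLaplaceLowerBound_le_EIG
    (h : ∀ᵐ ω ∂P, IsLaplacePoint prior (φ (y ω)) ε (m (y ω)))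
    (hgain : Integrable
      (fun ω => (klDiv (posterior prior (φ (y ω)) ε) (priorMeasure prior)).toReal) P)
    (hdiv : Integrable (fun ω => (laplaceDivergence prior (φ (y ω)) ε (m (y ω))).toReal) P) :
    EIGLaplaceLowerBound P prior φ m y ε ≤ EIG P prior φ y ε := by
  rw [← sub_nonneg, EIG_sub_EIGLaplaceLowerBound h hgain hdiv]
  exact integral_nonneg fun _ => ENNReal.toReal_nonneg

end ExpectedInformationGain

section LaplaceAssumption

variable {d : ℕ} {prior : EuclideanSpace ℝ (Fin d) → ℝ} {ε₀ : ℝ}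
  {Φ : ℝ → EuclideanSpace ℝ (Fin d) → ℝ} {u : ℝ → EuclideanSpace ℝ (Fin d)}

namespace LaplaceAssumption

lemma exists_tendsto_hessian_regPotential (h : LaplaceAssumption ε₀ prior Φ u)
    (hprior : IsPriorDensity prior) (hε₀ : 0 < ε₀) :
    ∃ H : Matrix (Fin d) (Fin d) ℝ, H.PosDef ∧
      Tendsto (fun ε => hessian (regPotential prior (Φ ε) ε) (u ε)) (𝓝[>] 0) (𝓝 H) := by
  obtain ⟨H, hH, hHlim⟩ := h.tendsto_hessian
  obtain ⟨v, hv⟩ := h.tendsto_min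
  refine ⟨H, hH, ?_⟩
  have hlog : ContDiff ℝ 2 fun x => Real.log (prior x) :=
    (h.contDiff_prior.log fun x => (hprior.pos x).ne').of_le (by norm_num)
  have hε : Tendsto (fun ε : ℝ => ε) (𝓝[>] 0) (𝓝 0) := nhdsWithin_le_nhds
  have hlim := hHlim.sub (hε.smul (((continuous_hessian hlog).tendsto v).comp hv))
  rw [zero_smul, sub_zero] at hlim
  refine hlim.congr' ?_
  filter_upwards [Ioc_mem_nhdsGT hε₀] with ε ⟨hε, hε'⟩
  exact (hessian_sub_const_smul ((h.contDiff_potential ε hε hε').of_le (by norm_num)).contDiffAt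
    hlog.contDiffAt ε).symm

lemma exists_eventually_norm_iteratedFDeriv_le (h : LaplaceAssumption ε₀ prior Φ u)
    (hprior : IsPriorDensity prior) (hε₀ : 0 < ε₀) :
    ∃ ρ K, 0 < ρ ∧ ∀ᶠ ε in 𝓝[>] (0 : ℝ), ∀ x ∈ Metric.ball (u ε) ρ,
      ‖iteratedFDeriv ℝ 3 (regPotential prior (Φ ε) ε) x‖ ≤ K := by
  obtain ⟨v, hv⟩ := h.tendsto_min
  obtain ⟨ε₁, _, K, hε₁, -, hK⟩ := h.separation_and_bounds (‖v‖ + 2) (by positivity)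
  refine ⟨1, K + |ε₀| * K, one_pos, ?_⟩
  have hu : ∀ᶠ ε in 𝓝[>] (0 : ℝ), ‖u ε‖ ≤ ‖v‖ + 1 :=
    hv.norm.eventually_le_const (lt_add_one _)
  filter_upwards [hu, Ioc_mem_nhdsGT hε₀, Ioc_mem_nhdsGT hε₁] with ε hu ⟨hε, hε'⟩ ⟨_, hε₁⟩ x hx
  have hx' : x ∈ Metric.closedBall (0 : EuclideanSpace ℝ (Fin d)) (‖v‖ + 2) := by
    rw [mem_closedBall_zero_iff]
    linarith [norm_le_norm_add_norm_sub' x (u ε), mem_ball_iff_norm.mp hx]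
  obtain ⟨hlogK, hΦK⟩ := (hK ε hε hε₁).2 x hx'
  have hlog : ContDiff ℝ 3 fun x => Real.log (prior x) :=
    h.contDiff_prior.log fun x => (hprior.pos x).ne'
  refine (norm_iteratedFDeriv_sub_const_smul_le (h.contDiff_potential ε hε hε').contDiffAt
    hlog.contDiffAt ε).trans ?_
  gcongr

theorem isUniformLaplaceFamily (h : LaplaceAssumption ε₀ prior Φ u)
    (hprior : IsPriorDensity prior) (hε₀ : 0 < ε₀) (hΦ : UniformlyBoundedBelow ε₀ Φ) :
    IsUniformLaplaceFamily ε₀ prior Φ u where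
  contDiff_prior := h.contDiff_prior
  contDiff_potential := h.contDiff_potential
  uniformlyBoundedBelow := hΦ
  nonneg ε hε hε' x := by
    rw [← h.min_eq_zero ε hε hε']
    rcases eq_or_ne x (u ε) with rfl | hx
    · exact le_rfl
    · exact (h.unique_min ε hε hε' x hx).le
  eq_zero := h.min_eq_zero
  hessian_posDef := h.hessian_posDef
  eventually_norm_le := by
    obtain ⟨v, hv⟩ := h.tendsto_min
    exact ⟨‖v‖ + 1, hv.norm.eventually_le_const (lt_add_one _)⟩
  eventually_quadForm_bounds := by
    obtain ⟨H, hH, hlim⟩ := h.exists_tendsto_hessian_regPotential hprior hε₀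
    obtain ⟨γ, M, hγ, hM, hbounds⟩ := exists_eventually_quadForm_bounds hH
    exact ⟨γ, M, hγ, hM, hlim.eventually hbounds⟩
  eventually_separated r hr := by
    obtain ⟨ε₁, δ, _, hε₁, hδ, hsep⟩ := h.separation_and_bounds r hr
    refine ⟨δ, hδ, ?_⟩
    filter_upwards [Ioc_mem_nhdsGT hε₁] with ε ⟨hε, hε'⟩
    exact (hsep ε hε hε').1
  eventually_norm_iteratedFDeriv_le := h.exists_eventually_norm_iteratedFDeriv_le hprior hε₀

end LaplaceAssumption

end LaplaceAssumption

end LaplaceKL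

theorem mainTheorem1_general {d : ℕ} (prior : EuclideanSpace ℝ (Fin d) → ℝ)
    (hprior : LaplaceKL.IsPriorDensity prior) (ε₀ : ℝ) (hε₀ : 0 < ε₀) :
    (∀ (Φ : ℝ → EuclideanSpace ℝ (Fin d) → ℝ) (u : ℝ → EuclideanSpace ℝ (Fin d)),
      LaplaceKL.IsUniformLaplaceFamily ε₀ prior Φ u →
      (∀ ε, 0 < ε → ε ≤ ε₀ → LaplaceKL.laplaceDivergence prior (Φ ε) ε (u ε) ≠ ⊤) ∧
      (fun ε : ℝ => (LaplaceKL.laplaceDivergence prior (Φ ε) ε (u ε)).toReal)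
        =O[𝓝[>] (0 : ℝ)] (fun ε : ℝ => ε ^ ((1 : ℝ) / 2))) ∧
    (∀ {Y Ω : Type*} [MeasurableSpace Ω] (P : Measure Ω)
      (y : ℝ → Ω → Y) (Φ : ℝ → Y → EuclideanSpace ℝ (Fin d) → ℝ)
      (u : ℝ → Y → EuclideanSpace ℝ (Fin d)),
      (∀ᵐ ω ∂P, LaplaceKL.IsUniformLaplaceFamily ε₀ prior (fun ε => Φ ε (y ε ω))
        (fun ε => u ε (y ε ω))) →
      (∀ ε, 0 < ε → ε ≤ ε₀ → Integrable (fun ω => (klDiv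
        (LaplaceKL.posterior prior (Φ ε (y ε ω)) ε) (LaplaceKL.priorMeasure prior)).toReal) P) →
      (∀ ε, 0 < ε → ε ≤ ε₀ → AEStronglyMeasurable (fun ω =>
        (LaplaceKL.laplaceDivergence prior (Φ ε (y ε ω)) ε (u ε (y ε ω))).toReal) P) →
      (∃ κ : Ω → ℝ, Integrable κ P ∧ ∀ ε, 0 < ε → ε ≤ ε₀ → ∀ᵐ ω ∂P,
        LaplaceKL.laplaceDivergence prior (Φ ε (y ε ω)) ε (u ε (y ε ω)) ≤
          ENNReal.ofReal (κ ω)) →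
      (∀ ε, 0 < ε → ε ≤ ε₀ →
        Integrable (fun ω => LaplaceKL.laplaceGain prior (Φ ε (y ε ω)) ε (u ε (y ε ω))) P ∧
        LaplaceKL.EIGLaplaceLowerBound P prior (Φ ε) (u ε) (y ε) ε ≤
          LaplaceKL.EIG P prior (Φ ε) (y ε) ε) ∧
      Tendsto (fun ε => LaplaceKL.EIG P prior (Φ ε) (y ε) ε -
        LaplaceKL.EIGLaplaceLowerBound P prior (Φ ε) (u ε) (y ε) ε) (𝓝[>] 0) (𝓝 0)) := by
  refine ⟨fun Φ u h => ⟨fun ε hε hε' =>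
    (h.isLaplacePoint hprior hε hε').laplaceDivergence_ne_top,
    h.laplaceDivergence_isBigO hprior hε₀⟩, ?_⟩
  intro Y Ω _ P y Φ u h hgain hmeas ⟨κ, hκ, hle⟩
  have hpoint (ε) (hε : 0 < ε) (hε' : ε ≤ ε₀) :
      ∀ᵐ ω ∂P, LaplaceKL.IsLaplacePoint prior (Φ ε (y ε ω)) ε (u ε (y ε ω)) :=
    h.mono fun ω hω => hω.isLaplacePoint hprior hε hε'
  have hdiv (ε) (hε : 0 < ε) (hε' : ε ≤ ε₀) : Integrable (fun ω =>
      (LaplaceKL.laplaceDivergence prior (Φ ε (y ε ω)) ε (u ε (y ε ω))).toReal) P :=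
    LaplaceKL.integrable_toReal_of_le_ofReal (hmeas ε hε hε') hκ (hle ε hε hε')
  have hev : ∀ᶠ ε in 𝓝[>] (0 : ℝ), 0 < ε ∧ ε ≤ ε₀ := Ioc_mem_nhdsGT hε₀
  refine ⟨fun ε hε hε' =>
    ⟨LaplaceKL.integrable_laplaceGain (hpoint ε hε hε') (hgain ε hε hε') (hdiv ε hε hε'),
    LaplaceKL.EIGLaplaceLowerBound_le_EIG (hpoint ε hε hε') (hgain ε hε hε') (hdiv ε hε hε')⟩, ?_⟩
  refine (LaplaceKL.tendsto_integral_toReal_zero (hev.mono fun ε hε => hmeas ε hε.1 hε.2) hκ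
    (hev.mono fun ε hε => hle ε hε.1 hε.2)
    (h.mono fun ω hω => hω.tendsto_laplaceDivergence hprior hε₀)).congr' ?_
  filter_upwards [hev] with ε ⟨hε, hε'⟩
  exact (LaplaceKL.EIG_sub_EIGLaplaceLowerBound (hpoint ε hε hε') (hgain ε hε hε')
    (hdiv ε hε hε')).symm

theorem mainTheorem1 {d : ℕ} (prior : EuclideanSpace ℝ (Fin d) → ℝ)
    (hprior : LaplaceKL.IsPriorDensity prior) (ε₀ : ℝ) (hε₀ : 0 < ε₀) :
    -- a given instance of the observations
    (∀ (Φ : ℝ → EuclideanSpace ℝ (Fin d) → ℝ) (u : ℝ → EuclideanSpace ℝ (Fin d)),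
      LaplaceKL.UniformlyBoundedBelow ε₀ Φ → LaplaceKL.LaplaceAssumption ε₀ prior Φ u →
      (∀ᶠ ε in 𝓝[>] (0 : ℝ), klDiv (LaplaceKL.posterior prior (Φ ε) ε)
        (LaplaceKL.laplaceApprox prior (Φ ε) ε (u ε)) ≠ ⊤) ∧
      (fun ε : ℝ => (klDiv (LaplaceKL.posterior prior (Φ ε) ε)
        (LaplaceKL.laplaceApprox prior (Φ ε) ε (u ε))).toReal)
          =O[𝓝[>] (0 : ℝ)] (fun ε : ℝ => ε ^ ((1 : ℝ) / 2))) ∧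
    -- random observations `y ε`: the lower bound on the expected information gain is tight
    (∀ {Y Ω : Type*} [MeasurableSpace Ω] (P : Measure Ω) [IsProbabilityMeasure P]
      (y : ℝ → Ω → Y) (Φ : ℝ → Y → EuclideanSpace ℝ (Fin d) → ℝ)
      (u : ℝ → Y → EuclideanSpace ℝ (Fin d)),
      (∀ᵐ ω ∂P, LaplaceKL.UniformlyBoundedBelow ε₀ (fun ε => Φ ε (y ε ω)) ∧
        LaplaceKL.LaplaceAssumption ε₀ prior (fun ε => Φ ε (y ε ω)) (fun ε => u ε (y ε ω))) →
      (∀ ε, 0 < ε → ε ≤ ε₀ → Integrable (fun ω => (klDiv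
        (LaplaceKL.posterior prior (Φ ε (y ε ω)) ε) (LaplaceKL.priorMeasure prior)).toReal) P) →
      (∀ ε, 0 < ε → ε ≤ ε₀ → AEStronglyMeasurable (fun ω => (klDiv
        (LaplaceKL.posterior prior (Φ ε (y ε ω)) ε)
        (LaplaceKL.laplaceApprox prior (Φ ε (y ε ω)) ε (u ε (y ε ω)))).toReal) P) →
      (∃ κ : Ω → ℝ, Integrable κ P ∧ ∀ ε, 0 < ε → ε ≤ ε₀ → ∀ᵐ ω ∂P,
        klDiv (LaplaceKL.posterior prior (Φ ε (y ε ω)) ε)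
          (LaplaceKL.laplaceApprox prior (Φ ε (y ε ω)) ε (u ε (y ε ω)))
            ≤ ENNReal.ofReal (κ ω)) →
      (∀ ε, 0 < ε → ε ≤ ε₀ →
        Integrable (fun ω => LaplaceKL.laplaceGain prior (Φ ε (y ε ω)) ε (u ε (y ε ω))) P ∧
        LaplaceKL.EIGLaplaceLowerBound P prior (Φ ε) (u ε) (y ε) ε ≤
          LaplaceKL.EIG P prior (Φ ε) (y ε) ε) ∧
      Tendsto (fun ε => LaplaceKL.EIG P prior (Φ ε) (y ε) ε -
        LaplaceKL.EIGLaplaceLowerBound P prior (Φ ε) (u ε) (y ε) ε) (𝓝[>] 0) (𝓝 0)) := by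
  obtain ⟨hfixed, hrandom⟩ := mainTheorem1_general prior hprior ε₀ hε₀
  refine ⟨fun Φ u hΦ h => ?_, fun P _ y Φ u h => hrandom P y Φ u
    (h.mono fun ω hω => hω.2.isUniformLaplaceFamily hprior hε₀ hω.1)⟩
  obtain ⟨hfinite, hrate⟩ := hfixed Φ u (h.isUniformLaplaceFamily hprior hε₀ hΦ)
  exact ⟨eventually_of_mem (Ioc_mem_nhdsGT hε₀) fun ε hε => hfinite ε hε.1 hε.2, hrate⟩
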